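/- Let $\mathcal G=(S,E)$ be a finite simple undirected graph, $c\ge 2$ an integer, and $L/K$ a (possibly infinite) Galois extension of subfields of $\mathbb C$. **The Lie algebra.** For a field $F\subset\mathbb C$ let $\mathfrak g^F_{\mathcal G}$ be the quotient of the free Lie algebra over $F$ on $S$ by the ideal generated by the brackets $[\alpha,\beta]$ with $\{\alpha,\beta\}\notin E$, and let $\mathfrak n^F_{\mathcal G,c}=\mathfrak g^F_{\mathcal G}/\gamma_{c+1}(\mathfrak g^F_{\mathcal G})$, where $\gamma_1(\mathfrak g)=\mathfrak g$ and $\gamma_{i+1}(\mathfrak g)=[\mathfrak g,\gamma_i(\mathfrak g)]$. The group $\mathrm{Gal}(L/K)$ acts on $\mathfrak n^L_{\mathcal G,c}$, written $v\mapsto{}^{\sigma}v$, by semi-linear maps that preserve brackets and fix the vertices. **The quotient graph.** Write $\Omega'(\alpha)$ for the set of neighbours of $\alpha$ and $\Omega(\alpha)=\Omega'(\alpha)\cup\{\alpha\}$. The coherent components of $\mathcal G$ are the classes of the equivalence relation $\alpha\sim\beta\Leftrightarrow\Omega'(\alpha)\subset\Omega(\beta)$ and $\Omega'(\beta)\subset\Omega(\alpha)$;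 let $\Lambda$ be the set of coherent components. The quotient graph $\overline{\mathcal G}$ has vertex set $\Lambda$, an edge (or loop) $\{\lambda,\mu\}$ whenever some $\alpha\in\lambda$ and $\beta\in\mu$ are adjacent, and weight $|\lambda|$ at $\lambda$. Its automorphism group $\mathrm{Aut}(\overline{\mathcal G})$ consists of the permutations of $\Lambda$ that preserve edges (in both directions) and weights. **The form.** Fix a group morphism $r:\mathrm{Aut}(\overline{\mathcal G})\to\mathrm{Aut}(\mathcal G)$ such that $r(\varphi)$ induces $\varphi$ on $\Lambda$ and such that $r(\varphi)$ is the identity on every coherent component $\lambda$ with $\varphi(\lambda)=\lambda$ (such $r$ exist). Let $i(\varphi)$ be the automorphism of $\mathfrak n^L_{\mathcal G,c}$ that permutes the vertices by $r(\varphi)$. For a group morphism $\rho:\mathrm{Gal}(L/K)\to\mathrm{Aut}(\overline{\mathcal G})$, continuous for the Krull topology and the discrete topology, consider the $K$-Lie algebra $$\mathfrak n^K_{\rho,c}=\{v\in\mathfrak n^L_{\mathcal G,c}\mid i(\rho_\sigma)({}^{\sigma}v)=v\ \text{ for all }\sigma\in\mathrm{Gal}(L/K)\}.$$ **The action on components.**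 Let $\mathcal C(\mathcal G)$ be the set of connected components of $\mathcal G$, and let $\chi:\mathrm{Aut}(\overline{\mathcal G})\to\mathrm{Perm}(\mathcal C(\mathcal G))$ be the following morphism. If $C\in\mathcal C(\mathcal G)$ has at least two vertices, then $C$ is a disjoint union of coherent components $\lambda_1,\dots,\lambda_k$ and $\chi(\varphi)(C)=\varphi(\lambda_1)\sqcup\dots\sqcup\varphi(\lambda_k)$; if $C$ is a single vertex, then $\chi(\varphi)(C)=C$. **Theorem.** The Lie algebra $\mathfrak n^K_{\rho,c}$ is indecomposable (that is, it is not the direct sum of two non-zero ideals) if and only if the action of $\mathrm{Gal}(L/K)$ on $\mathcal C(\mathcal G)$ through $\chi\circ\rho$ is transitive, i.e. any two connected components lie in the same orbit. -/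

import Mathlib

open scoped Topology

noncomputable section

namespace GraphLie

universe u v w

/-! ### Coherent components and the quotient graph -/

section Graph

variable {S : Type u} (G : SimpleGraph S)

/-- `α ≺ β`: the open neighbourhood of `α` is contained in the closed neighbourhood of `β`. -/
def Prec (α β : S) : Prop := G.neighborSet α ⊆ insert β (G.neighborSet β)

variable {G} in
theorem Prec.trans {α β γ : S} (h₁ : Prec G α β) (h₂ : Prec G β γ) : Prec G α γ := by
  intro δ hδ
  rcases h₁ hδ with rfl | hβ
  · have hδ' : G.Adj δ α := SimpleGraph.Adj.symm hδ
    rcases h₂ hδ' with rfl | h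
    · exact Or.inr hδ
    · have hγ : G.Adj α γ := SimpleGraph.Adj.symm h
      rcases h₁ hγ with rfl | h'
      · exact Or.inl rfl
      · have h'' : G.Adj γ δ := SimpleGraph.Adj.symm h'
        exact Or.inr h''
  · exact h₂ hβ

/-- The equivalence relation `α ∼ β ↔ α ≺ β ∧ β ≺ α`, whose classes are the coherent
components. -/
def coherent : Setoid S where
  r α β := Prec G α β ∧ Prec G β α
  iseqv :=
    { refl := fun _ => ⟨Set.subset_insert _ _, Set.subset_insert _ _⟩
      symm := fun h => ⟨h.2, h.1⟩
      trans := fun h₁ h₂ => ⟨h₁.1.trans h₂.1, h₂.2.trans h₁.2⟩ }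

/-- The set `Λ` of coherent components of `G`. -/
def CohComp : Type u := Quotient (coherent G)

/-- The coherent component of a vertex. -/
def cohMk (α : S) : CohComp G := Quotient.mk (coherent G) α

theorem cohMk_surjective : Function.Surjective (cohMk G) := Quotient.mk_surjective

theorem cohMk_eq_iff {α β : S} : cohMk G α = cohMk G β ↔ Prec G α β ∧ Prec G β α :=
  Quotient.eq (r := coherent G)

end Graph

/-- Undirected graphs with at most one edge between two vertices, loops allowed, and real weights
on the vertices. -/
structure WeightedLoopGraph (V : Type u) where
  /-- adjacency; `Adj v v` means that there is a loop at `v` -/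
  Adj : V → V → Prop
  symm : ∀ v w, Adj v w → Adj w v
  /-- the weight of a vertex -/
  weight : V → ℝ

/-- The automorphism group: permutations preserving edges in both directions and the weights. -/
def WeightedLoopGraph.aut {V : Type u} (Q : WeightedLoopGraph V) : Subgroup (Equiv.Perm V) where
  carrier := {φ | (∀ v w, Q.Adj v w ↔ Q.Adj (φ v) (φ w)) ∧ ∀ v, Q.weight (φ v) = Q.weight v}
  one_mem' := ⟨fun _ _ => Iff.rfl, fun _ => rfl⟩
  mul_mem' := fun {φ ψ} hφ hψ =>
    ⟨fun v w => (hψ.1 v w).trans (hφ.1 (ψ v) (ψ w)), fun v => (hφ.2 (ψ v)).trans (hψ.2 v)⟩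
  inv_mem' := fun {φ} hφ =>
    ⟨fun v w => by
      have := hφ.1 (φ.symm v) (φ.symm w)
      rw [Equiv.apply_symm_apply, Equiv.apply_symm_apply] at this
      exact this.symm,
    fun v => by
      have := hφ.2 (φ.symm v)
      rw [Equiv.apply_symm_apply] at this
      exact this.symm⟩

section Graph

variable {S : Type u} (G : SimpleGraph S)

/-- The quotient graph: its vertices are the coherent components, two of them (possibly equal) are
joined if they contain adjacent vertices, and the weight is the cardinality. -/
def quotientGraph : WeightedLoopGraph (CohComp G) where
  Adj l m := ∃ α β : S, cohMk G α = l ∧ cohMk G β = m ∧ G.Adj α β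
  symm := fun _ _ ⟨α, β, h₁, h₂, h⟩ => ⟨β, α, h₂, h₁, h.symm⟩
  weight l := (Nat.card {α : S // cohMk G α = l} : ℝ)

/-- The group of automorphisms of the quotient graph. -/
abbrev AutQuot : Type u := (quotientGraph G).aut

/-- A splitting `r : Aut(quotient graph) → Aut(G)`: a group morphism such that `r φ` induces `φ` on
the coherent components, and such that `r φ` is the identity on every coherent component that is
fixed by `φ`. -/
def IsSplitting (r : AutQuot G →* (G ≃g G)) : Prop :=
  (∀ (φ : AutQuot G) (α : S), cohMk G (r φ α) = φ.1 (cohMk G α)) ∧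
  (∀ (φ : AutQuot G) (α : S), φ.1 (cohMk G α) = cohMk G α → r φ α = α)

variable {G}

theorem adj_of_coherent {α β α' β' : S} (hα : cohMk G α = cohMk G α')
    (hβ : cohMk G β = cohMk G β') (hne : α' ≠ β') (h : G.Adj α β) : G.Adj α' β' := by
  rw [cohMk_eq_iff] at hα hβ
  have aux : ∀ {x y z : S}, Prec G x y → G.Adj x z → z ≠ y → G.Adj y z := fun hp ha hz =>
    (hp ha).resolve_left hz
  by_cases h1 : β = α'
  · subst h1
    by_cases h2 : α = β'
    · subst h2; exact h.symm
    · have h3 : G.Adj β' α := aux hβ.1 h.symm h2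
      exact (aux hα.1 h3.symm hne.symm)
  · have h3 : G.Adj α' β := aux hα.1 h h1
    exact (aux hβ.1 h3.symm hne).symm

theorem quotientGraph_adj_iff {α β : S} (hne : α ≠ β) :
    (quotientGraph G).Adj (cohMk G α) (cohMk G β) ↔ G.Adj α β :=
  ⟨fun ⟨_, _, h₁, h₂, h⟩ => adj_of_coherent h₁ h₂ hne h, fun h => ⟨α, β, rfl, rfl, h⟩⟩

/-- Splittings exist: number the vertices of every coherent component, and let `r φ` send the
`i`-th vertex of a component `l` to the `i`-th vertex of `φ l`. -/
theorem exists_isSplitting {S : Type u} [Finite S] (G : SimpleGraph S) :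
    ∃ r : AutQuot G →* (G ≃g G), IsSplitting G r := by
  let n : CohComp G → ℕ := fun l => Nat.card {α : S // cohMk G α = l}
  let e : ∀ l, {α : S // cohMk G α = l} ≃ Fin (n l) := fun l => Finite.equivFin _
  have hn : ∀ (φ : AutQuot G) l, n (φ.1 l) = n l := fun φ l => Nat.cast_injective (φ.2.2 l)
  let p : S → ℕ := fun α => (e (cohMk G α) ⟨α, rfl⟩ : Fin _).1
  have hp : ∀ α β, cohMk G α = cohMk G β → p α = p β → α = β := by
    intro α β h h'
    have : ∀ l (hl : cohMk G α = l), (e l ⟨α, hl⟩).1 = p α := by rintro _ rfl; rfl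
    have h1 : e (cohMk G β) ⟨α, h⟩ = e (cohMk G β) ⟨β, rfl⟩ := Fin.ext ((this _ h).trans h')
    exact congrArg Subtype.val ((e _).injective h1)
  have hex : ∀ (φ : AutQuot G) (α : S), ∃ β, cohMk G β = φ.1 (cohMk G α) ∧ p β = p α := by
    intro φ α
    let b := (e (φ.1 (cohMk G α))).symm ⟨p α, by rw [hn]; exact (e (cohMk G α) ⟨α, rfl⟩).2⟩
    refine ⟨b.1, b.2, ?_⟩
    have : ∀ l (x : {α : S // cohMk G α = l}), p x.1 = (e l x).1 := by rintro _ ⟨x, rfl⟩; rfl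
    rw [this _ b, Equiv.apply_symm_apply]
  choose f hf using hex
  have hmul : ∀ φ ψ α, f (φ * ψ) α = f φ (f ψ α) := fun φ ψ α =>
    hp _ _ (by rw [(hf _ _).1, (hf _ _).1, (hf _ _).1]; rfl)
      (by rw [(hf _ _).2, (hf _ _).2, (hf _ _).2])
  have hfix : ∀ (φ : AutQuot G) α, φ.1 (cohMk G α) = cohMk G α → f φ α = α := fun φ α h =>
    hp _ _ ((hf φ α).1.trans h) (hf φ α).2
  have hone : ∀ α, f 1 α = α := fun α => hfix 1 α rfl
  have hadj : ∀ φ {α β}, G.Adj α β → G.Adj (f φ α) (f φ β) := fun φ α β h => by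
    have hinj : f φ α ≠ f φ β := fun h' => h.ne (by
      rw [← hone α, ← hone β, ← inv_mul_cancel φ, hmul, hmul, h'])
    rw [← quotientGraph_adj_iff hinj, (hf φ α).1, (hf φ β).1]
    exact (φ.2.1 _ _).1 ⟨α, β, rfl, rfl, h⟩
  let r : AutQuot G →* (G ≃g G) :=
    { toFun := fun φ =>
        { toFun := f φ
          invFun := f φ⁻¹
          left_inv := fun α => by rw [← hmul, inv_mul_cancel, hone]
          right_inv := fun α => by rw [← hmul, mul_inv_cancel, hone]
          map_rel_iff' := fun {α β} => ⟨fun h => by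
            have := hadj φ⁻¹ h
            change G.Adj (f φ⁻¹ (f φ α)) (f φ⁻¹ (f φ β)) at this
            rwa [← hmul, ← hmul, inv_mul_cancel, hone, hone] at this, hadj φ⟩ }
      map_one' := RelIso.ext hone
      map_mul' := fun φ ψ => RelIso.ext (hmul φ ψ) }
  exact ⟨r, fun φ α => (hf φ α).1, hfix⟩

/-! ### The action of `Aut(quotient graph)` on the connected components -/

theorem reachable_of_class (φ : AutQuot G) {α β α' β' : S} (h : G.Reachable α β)
    (hαβ : α = β → ∃ γ, G.Adj α γ) (hα : cohMk G α' = φ.1 (cohMk G α))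
    (hβ : cohMk G β' = φ.1 (cohMk G β)) : G.Reachable α' β' := by
  have step : ∀ {x y x' y' : S}, G.Adj x y → cohMk G x' = φ.1 (cohMk G x) →
      cohMk G y' = φ.1 (cohMk G y) → G.Reachable x' y' := by
    intro x y x' y' hxy hx hy
    by_cases hne : x' = y'
    · rw [hne]
    · have h1 : (quotientGraph G).Adj (cohMk G x') (cohMk G y') := by
        rw [hx, hy]
        exact (φ.2.1 _ _).1 ⟨x, y, rfl, rfl, hxy⟩
      exact ((quotientGraph_adj_iff hne).1 h1).reachable
  have main : ∀ {x y : S} (p : G.Walk x y) (x' y' : S), ¬ p.Nil →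
      cohMk G x' = φ.1 (cohMk G x) → cohMk G y' = φ.1 (cohMk G y) → G.Reachable x' y' := by
    intro x y p
    induction p with
    | nil => intro _ _ h; exact absurd SimpleGraph.Walk.nil_nil h
    | @cons x z y hxz q ih =>
      intro x' y' _ hx hy
      obtain ⟨z', hz⟩ := cohMk_surjective G (φ.1 (cohMk G z))
      by_cases hq : q.Nil
      · have := hq.eq
        subst this
        exact step hxz hx hy
      · exact (step hxz hx hz).trans (ih z' y' hq hz hy)
  obtain ⟨p⟩ := h
  by_cases hp : p.Nil
  · have := hp.eq
    subst this
    obtain ⟨γ, hγ⟩ := hαβ rfl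
    obtain ⟨γ', hγ'⟩ := cohMk_surjective G (φ.1 (cohMk G γ))
    exact (step hγ hα hγ').trans (step hγ hβ hγ').symm
  · exact main p α' β' hp hα hβ

theorem exists_adj_of_not_subsingleton {C : G.ConnectedComponent} (hC : ¬ C.supp.Subsingleton)
    {α : S} (hα : G.connectedComponentMk α = C) : ∃ γ, G.Adj α γ := by
  rw [Set.not_subsingleton_iff] at hC
  obtain ⟨β, hβ, hne⟩ := hC.exists_ne α
  have hβ' : G.connectedComponentMk β = C := hβ
  obtain ⟨p⟩ := SimpleGraph.ConnectedComponent.exact (hα.trans hβ'.symm)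
  cases p with
  | nil => exact absurd rfl hne
  | cons h _ => exact ⟨_, h⟩

theorem not_subsingleton_of_adj {α γ : S} (h : G.Adj α γ) :
    ¬ (G.connectedComponentMk α).supp.Subsingleton := fun hs =>
  h.ne (hs (SimpleGraph.ConnectedComponent.connectedComponentMk_mem)
    (SimpleGraph.ConnectedComponent.connectedComponentMk_eq_of_adj h.symm))

theorem exists_adj_of_class (φ : AutQuot G) {α α' : S} (hα : cohMk G α' = φ.1 (cohMk G α))
    (h : ∃ γ, G.Adj α γ) : ∃ γ, G.Adj α' γ := by
  obtain ⟨γ, hγ⟩ := h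
  obtain ⟨x, y, hx, -, hxy⟩ :=
    (φ.2.1 (cohMk G α) (cohMk G γ)).1 ⟨α, γ, rfl, rfl, hγ⟩
  by_cases hne : y = α'
  · subst hne
    exact ⟨x, hxy.symm⟩
  · exact ⟨y, adj_of_coherent (hx.trans hα.symm) rfl (Ne.symm hne) hxy⟩

open Classical in
/-- The image of a connected component `C` under an automorphism `φ` of the quotient graph. If `C`
is a singleton, it is `C`. Otherwise `C` is a union of coherent components, and the image is the
union of their images under `φ` (see `mem_supp_chiFun`). -/
def chiFun (φ : AutQuot G) (C : G.ConnectedComponent) : G.ConnectedComponent :=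
  if C.supp.Subsingleton then C
  else G.connectedComponentMk (Quotient.out (s := coherent G) (φ.1 (cohMk G C.out)))

theorem chiFun_of_subsingleton (φ : AutQuot G) {C : G.ConnectedComponent}
    (hC : C.supp.Subsingleton) : chiFun φ C = C := if_pos hC

theorem chiFun_eq (φ : AutQuot G) {C : G.ConnectedComponent} (hC : ¬ C.supp.Subsingleton)
    {α β : S} (hα : G.connectedComponentMk α = C) (hβ : cohMk G β = φ.1 (cohMk G α)) :
    chiFun φ C = G.connectedComponentMk β := by
  have hout : G.connectedComponentMk C.out = C := Quot.out_eq C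
  rw [chiFun, if_neg hC]
  refine SimpleGraph.ConnectedComponent.sound ?_
  exact reachable_of_class φ (SimpleGraph.ConnectedComponent.exact (hout.trans hα.symm))
    (fun _ => exists_adj_of_not_subsingleton hC hout) (Quotient.out_eq (s := coherent G) _) hβ

theorem chiFun_not_subsingleton (φ : AutQuot G) {C : G.ConnectedComponent}
    (hC : ¬ C.supp.Subsingleton) : ¬ (chiFun φ C).supp.Subsingleton := by
  have hout : G.connectedComponentMk C.out = C := Quot.out_eq C
  obtain ⟨β, hβ⟩ := cohMk_surjective G (φ.1 (cohMk G C.out))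
  rw [chiFun_eq φ hC hout hβ]
  obtain ⟨γ, hγ⟩ := exists_adj_of_class φ hβ (exists_adj_of_not_subsingleton hC hout)
  exact not_subsingleton_of_adj hγ

theorem chiFun_one (C : G.ConnectedComponent) : chiFun (1 : AutQuot G) C = C := by
  by_cases hC : C.supp.Subsingleton
  · exact chiFun_of_subsingleton _ hC
  · have hout : G.connectedComponentMk C.out = C := Quot.out_eq C
    rw [chiFun_eq 1 hC hout (β := C.out) rfl, hout]

theorem chiFun_mul (φ ψ : AutQuot G) (C : G.ConnectedComponent) :
    chiFun (φ * ψ) C = chiFun φ (chiFun ψ C) := by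
  by_cases hC : C.supp.Subsingleton
  · rw [chiFun_of_subsingleton _ hC, chiFun_of_subsingleton _ hC, chiFun_of_subsingleton _ hC]
  · have hout : G.connectedComponentMk C.out = C := Quot.out_eq C
    obtain ⟨β, hβ⟩ := cohMk_surjective G (ψ.1 (cohMk G C.out))
    obtain ⟨γ, hγ⟩ := cohMk_surjective G (φ.1 (cohMk G β))
    have h1 := chiFun_eq ψ hC hout hβ
    rw [chiFun_eq φ (chiFun_not_subsingleton ψ hC) h1.symm hγ]
    refine chiFun_eq (φ * ψ) hC hout ?_
    rw [hγ, hβ]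
    rfl

/-- If `C` has at least two vertices, the image of `C` is the union of the images under `φ` of the
coherent components that meet `C`. -/
theorem mem_supp_chiFun (φ : AutQuot G) {C : G.ConnectedComponent} (hC : ¬ C.supp.Subsingleton)
    (β : S) : β ∈ (chiFun φ C).supp ↔ ∃ α ∈ C.supp, φ.1 (cohMk G α) = cohMk G β := by
  constructor
  · intro hβ
    have hβ' : G.connectedComponentMk β = chiFun φ C := hβ
    obtain ⟨α, hα⟩ := cohMk_surjective G ((φ⁻¹).1 (cohMk G β))
    refine ⟨α, ?_, ?_⟩
    · have h1 := chiFun_eq φ⁻¹ (chiFun_not_subsingleton φ hC) hβ' hα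
      rw [← chiFun_mul, inv_mul_cancel, chiFun_one] at h1
      exact h1.symm
    · rw [hα]
      exact Equiv.apply_symm_apply φ.1 _
  · rintro ⟨α, hα, h⟩
    exact (chiFun_eq φ hC hα h.symm).symm

variable (G)

/-- The morphism `χ` from the automorphism group of the quotient graph to the group of permutations
of the set of connected components of `G`. -/
def chi : AutQuot G →* Equiv.Perm G.ConnectedComponent where
  toFun φ :=
    { toFun := chiFun φ
      invFun := chiFun φ⁻¹
      left_inv := fun C => by rw [← chiFun_mul, inv_mul_cancel, chiFun_one]
      right_inv := fun C => by rw [← chiFun_mul, mul_inv_cancel, chiFun_one] }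
  map_one' := Equiv.ext chiFun_one
  map_mul' φ ψ := Equiv.ext (chiFun_mul φ ψ)

end Graph

/-! ### The nilpotent Lie algebra of a graph -/

section LieAlg

variable (K : Type v) [Field K] {S : Type u} (G : SimpleGraph S) (c : ℕ)

/-- The ideal of the free Lie algebra on the vertices generated by the brackets of the pairs of
vertices that are not joined by an edge. -/
def graphIdeal : LieIdeal K (FreeLieAlgebra K S) :=
  LieSubmodule.lieSpan K (FreeLieAlgebra K S)
    {x | ∃ α β : S, ¬ G.Adj α β ∧ x = ⁅FreeLieAlgebra.of K α, FreeLieAlgebra.of K β⁆}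

/-- The Lie algebra over `K` associated to the graph `G`. -/
def GraphLieAlg : Type (max u v) := FreeLieAlgebra K S ⧸ graphIdeal K G

instance : LieRing (GraphLieAlg K G) :=
  inferInstanceAs (LieRing (FreeLieAlgebra K S ⧸ graphIdeal K G))

instance : LieAlgebra K (GraphLieAlg K G) :=
  inferInstanceAs (LieAlgebra K (FreeLieAlgebra K S ⧸ graphIdeal K G))

/-- The `c`-step nilpotent Lie algebra over `K` associated to the graph `G`. In Mathlib the lower
central series starts with index `0`, so that the ideal divided out is the `(c + 1)`-st term of the
lower central series whose first term is the whole Lie algebra. -/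
def NilLieAlg : Type (max u v) :=
  GraphLieAlg K G ⧸ LieModule.lowerCentralSeries K (GraphLieAlg K G) (GraphLieAlg K G) c

instance : LieRing (NilLieAlg K G c) :=
  inferInstanceAs (LieRing
    (GraphLieAlg K G ⧸ LieModule.lowerCentralSeries K (GraphLieAlg K G) (GraphLieAlg K G) c))

instance : LieAlgebra K (NilLieAlg K G c) :=
  inferInstanceAs (LieAlgebra K
    (GraphLieAlg K G ⧸ LieModule.lowerCentralSeries K (GraphLieAlg K G) (GraphLieAlg K G) c))

/-- The projection of a Lie algebra onto its quotient by an ideal. -/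
def quotMk {A : Type w} [LieRing A] [LieAlgebra K A] (I : LieIdeal K A) : A →ₗ⁅K⁆ A ⧸ I :=
  { I.toSubmodule.mkQ with map_lie' := fun {_ _} => rfl }

/-- A morphism of Lie algebras that vanishes on an ideal factors through the quotient. -/
def quotLift {A B : Type*} [LieRing A] [LieAlgebra K A] [LieRing B] [LieAlgebra K B]
    (I : LieIdeal K A) (f : A →ₗ⁅K⁆ B) (h : ∀ x ∈ I, f x = 0) : A ⧸ I →ₗ⁅K⁆ B :=
  { I.toSubmodule.liftQ (f : A →ₗ[K] B) h with
    map_lie' := by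
      intro x y
      obtain ⟨x, rfl⟩ := Submodule.Quotient.mk_surjective _ x
      obtain ⟨y, rfl⟩ := Submodule.Quotient.mk_surjective _ y
      exact f.map_lie x y }

/-- The canonical projection from the free Lie algebra on the vertices. -/
def proj : FreeLieAlgebra K S →ₗ⁅K⁆ NilLieAlg K G c :=
  (show GraphLieAlg K G →ₗ⁅K⁆ NilLieAlg K G c from quotMk K _).comp
    (show FreeLieAlgebra K S →ₗ⁅K⁆ GraphLieAlg K G from quotMk K _)

theorem proj_surjective : Function.Surjective (proj K G c) := by
  intro x
  obtain ⟨y, rfl⟩ := Submodule.Quotient.mk_surjective _ x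
  obtain ⟨z, rfl⟩ := Submodule.Quotient.mk_surjective _ y
  exact ⟨z, rfl⟩

/-- The vertices as elements of the Lie algebra. -/
def vertex (α : S) : NilLieAlg K G c := proj K G c (FreeLieAlgebra.of K α)

variable {K G c}

theorem lie_vertex {α β : S} (h : ¬ G.Adj α β) : ⁅vertex K G c α, vertex K G c β⁆ = 0 := by
  have h1 : ⁅FreeLieAlgebra.of K α, FreeLieAlgebra.of K β⁆ ∈ graphIdeal K G :=
    LieSubmodule.subset_lieSpan ⟨α, β, h, rfl⟩
  have h2 : (Submodule.Quotient.mk ⁅FreeLieAlgebra.of K α, FreeLieAlgebra.of K β⁆ :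
      FreeLieAlgebra K S ⧸ graphIdeal K G) = 0 := (Submodule.Quotient.mk_eq_zero _).2 h1
  rw [vertex, vertex, ← LieHom.map_lie]
  exact congrArg (quotMk K (LieModule.lowerCentralSeries K (GraphLieAlg K G) (GraphLieAlg K G) c))
    h2 |>.trans (map_zero _)

theorem lowerCentralSeries_nilLieAlg :
    LieModule.lowerCentralSeries K (NilLieAlg K G c) (NilLieAlg K G c) c = ⊥ := by
  let q : GraphLieAlg K G →ₗ⁅K⁆ NilLieAlg K G c := quotMk K _
  have hq : Function.Surjective q := Submodule.Quotient.mk_surjective _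
  rw [← LieIdeal.lowerCentralSeries_map_eq c hq, eq_bot_iff, LieIdeal.map_le]
  rintro _ ⟨x, hx, rfl⟩
  exact (Submodule.Quotient.mk_eq_zero _).2 hx

theorem hom_ext {B : Type*} [LieRing B] [LieAlgebra K B] {f g : NilLieAlg K G c →ₗ⁅K⁆ B}
    (h : ∀ α, f (vertex K G c α) = g (vertex K G c α)) : f = g := by
  have h1 : f.comp (proj K G c) = g.comp (proj K G c) := FreeLieAlgebra.hom_ext h
  ext x
  obtain ⟨y, rfl⟩ := proj_surjective K G c x
  exact LieHom.congr_fun h1 y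

/-- The universal property: a map from the vertices to a Lie algebra of nilpotency class at most
`c`, under which non-adjacent vertices have commuting images, extends to a morphism. -/
def lift {B : Type*} [LieRing B] [LieAlgebra K B] (f : S → B)
    (hf : ∀ α β, ¬ G.Adj α β → ⁅f α, f β⁆ = 0)
    (hB : LieModule.lowerCentralSeries K B B c = ⊥) : NilLieAlg K G c →ₗ⁅K⁆ B :=
  let g : GraphLieAlg K G →ₗ⁅K⁆ B := quotLift K (graphIdeal K G) (FreeLieAlgebra.lift K f) (by
    have h1 : graphIdeal K G ≤ (FreeLieAlgebra.lift K f).ker := by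
      refine LieSubmodule.lieSpan_le.2 ?_
      rintro _ ⟨α, β, h, rfl⟩
      refine LieHom.mem_ker.2 ?_
      rw [LieHom.map_lie, FreeLieAlgebra.lift_of_apply, FreeLieAlgebra.lift_of_apply, hf α β h]
    exact fun x hx => LieHom.mem_ker.1 (h1 hx))
  quotLift K _ g (fun x hx => by
    have h1 := LieIdeal.map_lowerCentralSeries_le (R := K) c (f := g) (LieIdeal.mem_map hx)
    rw [hB] at h1
    exact (LieSubmodule.mem_bot _).1 h1)

theorem lift_vertex {B : Type*} [LieRing B] [LieAlgebra K B] (f : S → B)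
    (hf : ∀ α β, ¬ G.Adj α β → ⁅f α, f β⁆ = 0)
    (hB : LieModule.lowerCentralSeries K B B c = ⊥) (α : S) :
    lift (c := c) f hf hB (vertex K G c α) = f α :=
  FreeLieAlgebra.lift_of_apply f α

variable (K c)

/-- The Lie algebra morphism that permutes the vertices by a graph automorphism. -/
def permHom (θ : G ≃g G) : NilLieAlg K G c →ₗ⁅K⁆ NilLieAlg K G c :=
  lift (fun α => vertex K G c (θ α)) (fun _ _ h => lie_vertex (fun h' => h (θ.map_adj_iff.1 h')))
    lowerCentralSeries_nilLieAlg

@[simp]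
theorem permHom_vertex (θ : G ≃g G) (α : S) :
    permHom K c θ (vertex K G c α) = vertex K G c (θ α) := lift_vertex _ _ _ α

theorem permHom_permHom (θ θ' : G ≃g G) (x : NilLieAlg K G c) :
    permHom K c θ (permHom K c θ' x) = permHom K c (θ * θ') x := by
  have : (permHom K c θ).comp (permHom K c θ') = permHom K c (θ * θ') :=
    hom_ext fun α => by simp
  exact LieHom.congr_fun this x

theorem permHom_one (x : NilLieAlg K G c) : permHom K c (1 : G ≃g G) x = x := by
  have : permHom K c (1 : G ≃g G) = LieHom.id := hom_ext fun α => by simp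
  exact LieHom.congr_fun this x

/-- The Lie algebra automorphism that permutes the vertices by a graph automorphism. -/
def permAut (θ : G ≃g G) : NilLieAlg K G c ≃ₗ⁅K⁆ NilLieAlg K G c :=
  { permHom K c θ with
    invFun := permHom K c θ⁻¹
    left_inv := fun x => by
      change permHom K c θ⁻¹ (permHom K c θ x) = x
      rw [permHom_permHom, inv_mul_cancel, permHom_one]
    right_inv := fun x => by
      change permHom K c θ (permHom K c θ⁻¹ x) = x
      rw [permHom_permHom, mul_inv_cancel, permHom_one] }

/-- The embedding `i` of the automorphism group of the quotient graph into the automorphisms of the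
Lie algebra, for a given splitting `r`: the automorphism `i φ` permutes the vertices by `r φ`. -/
def iota (r : AutQuot G →* (G ≃g G)) (φ : AutQuot G) : NilLieAlg K G c ≃ₗ⁅K⁆ NilLieAlg K G c :=
  permAut K c (r φ)

end LieAlg

/-! ### The Galois action and the form defined by a morphism -/

section Galois

/-- A copy of a Lie algebra over `L`, on which `l : L` acts as `σ l`. -/
def Twist {L : Type v} [Field L] (_ : L →+* L) (A : Type w) : Type w := A

section Twist

variable {L : Type v} [Field L] (σ : L →+* L) (A : Type w) [LieRing A] [LieAlgebra L A]

instance : LieRing (Twist σ A) := inferInstanceAs (LieRing A)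

instance : Module L (Twist σ A) := Module.compHom A σ

instance : LieAlgebra L (Twist σ A) where
  lie_smul l x y := lie_smul (σ l) (show A from x) (show A from y)

theorem lowerCentralSeries_twist {k : ℕ} (h : LieModule.lowerCentralSeries L A A k = ⊥) :
    LieModule.lowerCentralSeries L (Twist σ A) (Twist σ A) k = ⊥ := by
  rw [SetLike.ext'_iff, LieModule.coe_lowerCentralSeries_eq_int] at h ⊢
  exact h

end Twist

variable (K : Type w) {L : Type v} [Field K] [Field L] [Algebra K L] {S : Type u}
  (G : SimpleGraph S) (c : ℕ)

variable {K} in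
/-- The morphism fixing the vertices from the Lie algebra over `L` to its twist by `σ`. -/
def galHom (σ : Gal(L/K)) :
    NilLieAlg L G c →ₗ⁅L⁆ Twist (σ : L →+* L) (NilLieAlg L G c) :=
  lift (fun α => (vertex L G c α : NilLieAlg L G c)) (fun _ _ h => lie_vertex h)
    (lowerCentralSeries_twist _ _ lowerCentralSeries_nilLieAlg)

variable {K} in
/-- The action of `σ` on the Lie algebra over `L`: the unique map fixing the vertices that is
additive, `σ`-semilinear and compatible with brackets. -/
def galAct (σ : Gal(L/K)) (x : NilLieAlg L G c) : NilLieAlg L G c := galHom G c σ x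

variable {K G c}

theorem galAct_vertex (σ : Gal(L/K)) (α : S) :
    galAct G c σ (vertex L G c α) = vertex L G c α :=
  lift_vertex (B := Twist (σ : L →+* L) (NilLieAlg L G c)) _ _ _ α

theorem galAct_add (σ : Gal(L/K)) (x y : NilLieAlg L G c) :
    galAct G c σ (x + y) = galAct G c σ x + galAct G c σ y := map_add (galHom G c σ) x y

theorem galAct_zero (σ : Gal(L/K)) : galAct G c σ (0 : NilLieAlg L G c) = 0 :=
  map_zero (galHom G c σ)

theorem galAct_smul (σ : Gal(L/K)) (l : L) (x : NilLieAlg L G c) :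
    galAct G c σ (l • x) = σ l • galAct G c σ x := map_smul (galHom G c σ) l x

theorem galAct_lie (σ : Gal(L/K)) (x y : NilLieAlg L G c) :
    galAct G c σ ⁅x, y⁆ = ⁅galAct G c σ x, galAct G c σ y⁆ := LieHom.map_lie (galHom G c σ) x y

variable (K) in
/-- The Lie algebra over `K` of all `v` in the `c`-step nilpotent Lie algebra of `G` over `L` with
`i (ρ σ) (σ v) = v` for all `σ`. -/
def form (r : AutQuot G →* (G ≃g G)) (ρ : Gal(L/K) →* AutQuot G) (c : ℕ) :
    LieSubalgebra K (RestrictScalars K L (NilLieAlg L G c)) where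
  carrier := {v : NilLieAlg L G c | ∀ σ : Gal(L/K), iota L c r (ρ σ) (galAct G c σ v) = v}
  zero_mem' := fun σ => by
    change iota L c r (ρ σ) (galAct G c σ (0 : NilLieAlg L G c)) = 0
    rw [galAct_zero, map_zero]
  add_mem' := fun {x y : NilLieAlg L G c} hx hy σ => by
    change iota L c r (ρ σ) (galAct G c σ (x + y)) = x + y
    rw [galAct_add, map_add, hx σ, hy σ]
  smul_mem' := fun k (x : NilLieAlg L G c) hx σ => by
    change iota L c r (ρ σ) (galAct G c σ (algebraMap K L k • x)) = algebraMap K L k • x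
    rw [galAct_smul, AlgEquiv.commutes, map_smul, hx σ]
  lie_mem' := fun {x y : NilLieAlg L G c} hx hy σ => by
    change iota L c r (ρ σ) (galAct G c σ ⁅x, y⁆) = ⁅x, y⁆
    rw [galAct_lie, LieEquiv.map_lie, hx σ, hy σ]

end Galois

/-- A Lie algebra is decomposable if it is the direct sum of two non-zero ideals. -/
def IsDecomposable (K : Type v) [Field K] (A : Type w) [LieRing A] [LieAlgebra K A] : Prop :=
  ∃ I J : LieIdeal K A, I ≠ ⊥ ∧ J ≠ ⊥ ∧ IsCompl I J

/-- A Lie algebra is indecomposable if it is not decomposable. -/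
def IsIndecomposable (K : Type v) [Field K] (A : Type w) [LieRing A] [LieAlgebra K A] : Prop :=
  ¬ IsDecomposable K A

end GraphLie

end

open scoped Topology

noncomputable section

/-! Write `n` for the Lie algebra over `L`. For each vertex there is a coordinate `coord`, a linear
form on `n` that kills brackets and is dual to the vertices in the abelianization. By Dedekind
independence of field embeddings, the form spans `n` over `L` (`mem_span_form`), so a linear form on
`n` is determined on the fixed vectors.

Suppose the form is a direct sum of ideals `I` and `J`. Then `I` and `J` commute. Every edge gives a
morphism from `n` to the Heisenberg algebra, because `c` is at least 2, and commuting elements have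
proportional pairs of coordinates at the two ends. If both summands had a nonzero pair, all pairs
would lie on one line, against the spanning property. So the pair vanishes identically on one
summand (`coord_eq_zero_or_of_adj`). Vanishing on a given summand spreads along paths, and by Galois
invariance along the orbits of components. Under transitivity it reaches every vertex, and one
summand lies in the derived algebra. The other then generates `n` modulo brackets, hence spans `n`
by nilpotency, and Galois descent makes the first summand zero (`eq_bot_of_coord_eq_zero`). Without
edges, transitivity leaves at most one vertex.

Conversely, an orbit of components and its complement split `n` into two commuting parts stable
under the twisted action. Each part contains a nonzero fixed vector, the sum over a Galois orbit of
vertices (`isDecomposable_of_invariant`). -/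

namespace GraphLie

universe u v w

/-! ### Generation by the vertices and coordinates in the abelianization -/

section Coordinates

attribute [local instance] LieRing.ofAssociativeRing

variable {K : Type v} [Field K] {S : Type u} {G : SimpleGraph S} {c : ℕ}

/-- The vertices generate the Lie algebra of a graph. -/
theorem eq_top_of_vertex_mem (B : LieSubalgebra K (NilLieAlg K G c))
    (hB : ∀ α, vertex K G c α ∈ B) (x : NilLieAlg K G c) : x ∈ B := by
  have h : B.incl.comp (FreeLieAlgebra.lift K fun α => (⟨vertex K G c α, hB α⟩ : B)) =
      proj K G c := by
    refine FreeLieAlgebra.hom_ext fun α => ?_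
    rw [LieHom.comp_apply, FreeLieAlgebra.lift_of_apply]
    rfl
  obtain ⟨y, rfl⟩ := proj_surjective K G c x
  rw [← h]
  exact (FreeLieAlgebra.lift K (fun α => (⟨vertex K G c α, hB α⟩ : B)) y).2

/-- The elements satisfying `P` form a Lie subalgebra containing the vertices. This serves for
claims that are not equalities of two Lie morphisms, such as those about semilinear maps or sums of
morphisms. -/
theorem induction_on {P : NilLieAlg K G c → Prop} (x : NilLieAlg K G c)
    (vertex : ∀ α, P (vertex K G c α)) (zero : P 0) (add : ∀ x y, P x → P y → P (x + y))
    (smul : ∀ (l : K) x, P x → P (l • x)) (lie : ∀ x y, P x → P y → P ⁅x, y⁆) : P x :=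
  eq_top_of_vertex_mem
    { carrier := {x | P x}
      zero_mem' := zero
      add_mem' := fun {x y} => add x y
      smul_mem' := smul
      lie_mem' := fun {x y} => lie x y } vertex x

theorem lowerCentralSeries_eq_bot_of_le {B : Type*} [LieRing B] [LieAlgebra K B] {k m : ℕ}
    (h : LieModule.lowerCentralSeries K B B k = ⊥) (hkm : k ≤ m) :
    LieModule.lowerCentralSeries K B B m = ⊥ :=
  eq_bot_iff.2 ((LieModule.antitone_lowerCentralSeries K B B hkm).trans h.le)

/-- An ideal that contains the vertices modulo brackets is the whole Lie algebra. -/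
theorem eq_top_of_sup_eq_top (Q : LieIdeal K (NilLieAlg K G c))
    (hQ : Q ⊔ LieModule.lowerCentralSeries K (NilLieAlg K G c) (NilLieAlg K G c) 1 = ⊤) :
    Q = ⊤ := by
  have step : ∀ k,
      Q ⊔ LieModule.lowerCentralSeries K (NilLieAlg K G c) (NilLieAlg K G c) k = ⊤ := by
    -- Bracketing the inclusion for `k` with the whole algebra gives the one for `k + 1`, as `Q`
    -- absorbs brackets. Nilpotency ends the chain at `k = c`.
    have h : ∀ k, LieModule.lowerCentralSeries K (NilLieAlg K G c) (NilLieAlg K G c) k ≤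
        Q ⊔ LieModule.lowerCentralSeries K (NilLieAlg K G c) (NilLieAlg K G c) (k + 1) := by
      intro k
      induction k with
      | zero => rw [hQ]; exact le_top
      | succ k ih =>
        rw [LieModule.lowerCentralSeries_succ, LieModule.lowerCentralSeries_succ _ _ _ (k + 1)]
        refine (LieSubmodule.mono_lie_right _ ih).trans ?_
        rw [LieSubmodule.lie_sup]
        exact sup_le_sup_right (LieSubmodule.lie_le_right _ _) _
    intro k
    induction k with
    | zero => rw [LieModule.lowerCentralSeries_zero, sup_top_eq]
    | succ k ih => exact eq_top_iff.2 (ih ▸ sup_le le_sup_left (h k))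
  have := step c
  rwa [lowerCentralSeries_nilLieAlg, sup_bot_eq] at this

variable (K G c) in
open Classical in
/-- The coordinate at a vertex of the image in the abelianization. -/
def coord [NeZero c] (α : S) : NilLieAlg K G c →ₗ⁅K⁆ K :=
  lift (fun β => if β = α then (1 : K) else 0)
    (fun _ _ _ => by rw [Ring.lie_def, mul_comm, sub_self])
    -- The field with its commutator bracket is abelian, so its series vanishes from index 1, and
    -- `NeZero c` supplies `1 ≤ c`.
    (lowerCentralSeries_eq_bot_of_le (k := 1)
      ((LieModule.trivial_iff_lower_central_eq_bot K K K).1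
        ⟨fun x y => by rw [Ring.lie_def, mul_comm, sub_self]⟩) (NeZero.one_le))

section

variable [NeZero c]

open Classical in
theorem coord_vertex (α β : S) : coord K G c α (vertex K G c β) = if β = α then 1 else 0 :=
  lift_vertex _ _ _ β

@[simp]
theorem coord_vertex_self (α : S) : coord K G c α (vertex K G c α) = 1 := by
  rw [coord_vertex, if_pos rfl]

theorem coord_vertex_of_ne {α β : S} (h : β ≠ α) : coord K G c α (vertex K G c β) = 0 := by
  rw [coord_vertex, if_neg h]

theorem coord_lie (α : S) (x y : NilLieAlg K G c) : coord K G c α ⁅x, y⁆ = 0 := by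
  rw [LieHom.map_lie, Ring.lie_def, mul_comm, sub_self]

theorem coord_permHom (θ : G ≃g G) (α : S) (x : NilLieAlg K G c) :
    coord K G c (θ α) (permHom K c θ x) = coord K G c α x := by
  have : (coord K G c (θ α)).comp (permHom K c θ) = coord K G c α := hom_ext fun β => by
    classical
    rw [LieHom.comp_apply, permHom_vertex, coord_vertex, coord_vertex]
    exact if_congr θ.injective.eq_iff rfl rfl
  exact LieHom.congr_fun this x

/-- Modulo brackets, an element is the combination of the vertices given by its coordinates. -/
theorem sub_sum_coord_mem [Fintype S] (x : NilLieAlg K G c) :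
    x - ∑ α, coord K G c α x • vertex K G c α ∈
      LieModule.lowerCentralSeries K (NilLieAlg K G c) (NilLieAlg K G c) 1 := by
  classical
  refine induction_on (P := fun x => x - ∑ α, coord K G c α x • vertex K G c α ∈
      LieModule.lowerCentralSeries K (NilLieAlg K G c) (NilLieAlg K G c) 1) x (fun β => ?_) ?_
    (fun x y hx hy => ?_) (fun l x hx => ?_) (fun x y _ _ => ?_)
  · simp [coord_vertex]
  · simp
  · convert add_mem hx hy using 1
    simp only [map_add, add_smul, Finset.sum_add_distrib]
    abel
  · convert SMulMemClass.smul_mem l hx using 1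
    simp only [map_smul, smul_sub, Finset.smul_sum, smul_smul, smul_eq_mul]
  · simp only [coord_lie, zero_smul, Finset.sum_const_zero, sub_zero]
    rw [LieModule.lowerCentralSeries_succ]
    exact LieSubmodule.lie_mem_lie (LieSubmodule.mem_top _) (LieSubmodule.mem_top _)

theorem mem_lowerCentralSeries_one [Finite S] {x : NilLieAlg K G c}
    (hx : ∀ α, coord K G c α x = 0) :
    x ∈ LieModule.lowerCentralSeries K (NilLieAlg K G c) (NilLieAlg K G c) 1 := by
  have := Fintype.ofFinite S
  simpa [hx] using sub_sum_coord_mem x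

end

/-! ### The Heisenberg algebra as a test for commutation along an edge -/

section Heisenberg

variable (K) in
/-- The Heisenberg Lie algebra. -/
def Heisenberg : Type v := K × K × K

instance : AddCommGroup (Heisenberg K) := inferInstanceAs (AddCommGroup (K × K × K))

instance : Module K (Heisenberg K) := inferInstanceAs (Module K (K × K × K))

instance : Bracket (Heisenberg K) (Heisenberg K) :=
  ⟨fun x y => (0, 0, x.1 * y.2.1 - x.2.1 * y.1)⟩

theorem Heisenberg.lie_def (x y : Heisenberg K) :
    ⁅x, y⁆ = ((0, 0, x.1 * y.2.1 - x.2.1 * y.1) : K × K × K) := rfl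

theorem Heisenberg.ext {R : Type v} {x y : Heisenberg R} (h₁ : x.1 = y.1) (h₂ : x.2.1 = y.2.1)
    (h₃ : x.2.2 = y.2.2) : x = y := Prod.ext h₁ (Prod.ext h₂ h₃)

instance : LieRing (Heisenberg K) where
  add_lie x y z := Heisenberg.ext (add_zero 0).symm (add_zero 0).symm (by
    change (x.1 + y.1) * z.2.1 - (x.2.1 + y.2.1) * z.1 =
      (x.1 * z.2.1 - x.2.1 * z.1) + (y.1 * z.2.1 - y.2.1 * z.1)
    ring)
  lie_add x y z := Heisenberg.ext (add_zero 0).symm (add_zero 0).symm (by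
    change x.1 * (y.2.1 + z.2.1) - x.2.1 * (y.1 + z.1) =
      (x.1 * y.2.1 - x.2.1 * y.1) + (x.1 * z.2.1 - x.2.1 * z.1)
    ring)
  lie_self x := Heisenberg.ext rfl rfl (by
    change x.1 * x.2.1 - x.2.1 * x.1 = 0
    ring)
  leibniz_lie x y z := Heisenberg.ext (add_zero 0).symm (add_zero 0).symm (by
    change x.1 * 0 - x.2.1 * 0 = (0 * z.2.1 - 0 * z.1) + (y.1 * 0 - y.2.1 * 0)
    ring)

instance : LieAlgebra K (Heisenberg K) where
  lie_smul t x y := Heisenberg.ext (mul_zero t).symm (mul_zero t).symm (by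
    change x.1 * (t * y.2.1) - x.2.1 * (t * y.1) = t * (x.1 * y.2.1 - x.2.1 * y.1)
    ring)

theorem Heisenberg.lie_lie (x y z : Heisenberg K) : ⁅x, ⁅y, z⁆⁆ = 0 :=
  Heisenberg.ext rfl rfl (by
    change x.1 * 0 - x.2.1 * 0 = 0
    ring)

theorem Heisenberg.lowerCentralSeries_two :
    LieModule.lowerCentralSeries K (Heisenberg K) (Heisenberg K) 2 = ⊥ := by
  rw [LieModule.lowerCentralSeries_succ, eq_bot_iff, LieSubmodule.lie_le_iff]
  rintro x - m hm
  rw [LieModule.lowerCentralSeries_succ] at hm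
  have : (⁅(⊤ : LieIdeal K (Heisenberg K)), LieModule.lowerCentralSeries K (Heisenberg K)
      (Heisenberg K) 0⁆ : LieSubmodule K (Heisenberg K) (Heisenberg K)) ≤
      LieModule.maxTrivSubmodule K (Heisenberg K) (Heisenberg K) := by
    rw [LieSubmodule.lie_le_iff]
    exact fun y _ z _ x => Heisenberg.lie_lie x y z
  exact (LieSubmodule.mem_bot _).2 (this hm x)

/-- The first coordinate of the Heisenberg Lie algebra. -/
def Heisenberg.fst : Heisenberg K →ₗ⁅K⁆ K where
  toFun x := x.1
  map_add' _ _ := rfl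
  map_smul' _ _ := rfl
  map_lie' {x y} := by rw [Ring.lie_def, mul_comm, sub_self]; rfl

/-- The second coordinate of the Heisenberg Lie algebra. -/
def Heisenberg.snd : Heisenberg K →ₗ⁅K⁆ K where
  toFun x := x.2.1
  map_add' _ _ := rfl
  map_smul' _ _ := rfl
  map_lie' {x y} := by rw [Ring.lie_def, mul_comm, sub_self]; rfl

/-- The coordinates of commuting elements at the two ends of an edge are proportional. -/
theorem coord_mul_coord_eq_of_lie_eq_zero [NeZero c] (hc : 2 ≤ c) {α β : S} (h : G.Adj α β)
    {x y : NilLieAlg K G c} (hxy : ⁅x, y⁆ = 0) :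
    coord K G c α x * coord K G c β y = coord K G c β x * coord K G c α y := by
  classical
  -- The ends of the edge go to the two generators and all other vertices to zero. A non-adjacent
  -- pair is never the pair of ends, so its images commute.
  let f : NilLieAlg K G c →ₗ⁅K⁆ Heisenberg K :=
    lift (fun γ => ((if γ = α then 1 else 0, if γ = β then 1 else 0, 0) : K × K × K))
      (fun γ δ hn => Heisenberg.ext rfl rfl (by
        change (if γ = α then (1 : K) else 0) * (if δ = β then 1 else 0) -
          (if γ = β then 1 else 0) * (if δ = α then 1 else 0) = 0
        have h1 : ¬ (γ = α ∧ δ = β) := by rintro ⟨rfl, rfl⟩; exact hn h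
        have h2 : ¬ (γ = β ∧ δ = α) := by rintro ⟨rfl, rfl⟩; exact hn h.symm
        rw [ite_zero_mul_ite_zero, ite_zero_mul_ite_zero, if_neg h1, if_neg h2, sub_zero]))
      (lowerCentralSeries_eq_bot_of_le Heisenberg.lowerCentralSeries_two hc)
  have hf : ∀ γ, f (vertex K G c γ) =
      ((if γ = α then 1 else 0, if γ = β then 1 else 0, 0) : K × K × K) := lift_vertex _ _ _
  have h1 : ∀ z, (f z).1 = coord K G c α z := by
    have : Heisenberg.fst.comp f = coord K G c α := hom_ext fun γ => by
      rw [coord_vertex, LieHom.comp_apply, hf]; rfl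
    exact LieHom.congr_fun this
  have h2 : ∀ z, (f z).2.1 = coord K G c β z := by
    have : Heisenberg.snd.comp f = coord K G c β := hom_ext fun γ => by
      rw [coord_vertex, LieHom.comp_apply, hf]; rfl
    exact LieHom.congr_fun this
  have h3 : ⁅f x, f y⁆ = 0 := by rw [← LieHom.map_lie, hxy, map_zero]
  -- The central coordinate of the bracket is the determinant of the two pairs of coordinates.
  have h4 : (f x).1 * (f y).2.1 - (f x).2.1 * (f y).1 = 0 :=
    congrArg (fun z : K × K × K => z.2.2) h3
  rw [h1, h2, h2, h1] at h4
  exact sub_eq_zero.1 h4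

end Heisenberg

/-! ### Restriction to a set of vertices -/

section Restriction

open Classical in
variable (K G c) in
/-- The endomorphism that fixes the vertices in `U` and kills the other vertices. -/
def restr (U : Set S) : NilLieAlg K G c →ₗ⁅K⁆ NilLieAlg K G c :=
  lift (fun α => if α ∈ U then vertex K G c α else 0) (fun α β h => by
    split_ifs
    · exact lie_vertex h
    · exact lie_zero _
    · exact zero_lie _
    · exact zero_lie _) lowerCentralSeries_nilLieAlg

theorem restr_vertex_of_mem {U : Set S} {α : S} (h : α ∈ U) :
    restr K G c U (vertex K G c α) = vertex K G c α :=
  (lift_vertex _ _ _ α).trans (if_pos h)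

theorem restr_vertex_of_notMem {U : Set S} {α : S} (h : α ∉ U) :
    restr K G c U (vertex K G c α) = 0 :=
  (lift_vertex _ _ _ α).trans (if_neg h)

theorem restr_restr_compl (U : Set S) (x : NilLieAlg K G c) :
    restr K G c U (restr K G c Uᶜ x) = 0 := by
  have : (restr K G c U).comp (restr K G c Uᶜ) = 0 := hom_ext fun α => by
    by_cases h : α ∈ U
    · rw [LieHom.comp_apply, restr_vertex_of_notMem (not_not.2 h), map_zero, LieHom.zero_apply]
    · rw [LieHom.comp_apply, restr_vertex_of_mem (U := Uᶜ) h, restr_vertex_of_notMem h,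
        LieHom.zero_apply]
  exact LieHom.congr_fun this x

/-- No edge joins `U` to its complement, so vertices on the two sides commute. By the Jacobi
identity this passes to brackets, in the second argument and then in the first. -/
theorem lie_restr_restr_compl {U : Set S} (hU : ∀ α β, G.Adj α β → α ∈ U → β ∈ U)
    (x y : NilLieAlg K G c) : ⁅restr K G c U x, restr K G c Uᶜ y⁆ = 0 := by
  have h1 : ∀ α (y : NilLieAlg K G c), ⁅restr K G c U (vertex K G c α), restr K G c Uᶜ y⁆ = 0 := by
    intro α y
    by_cases hα : α ∈ U
    · rw [restr_vertex_of_mem hα]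
      refine induction_on (P := fun y => ⁅vertex K G c α, restr K G c Uᶜ y⁆ = 0) y
        (fun β => ?_) ?_ (fun x y hx hy => ?_) (fun l x hx => ?_)
        (fun x y hx hy => ?_)
      · by_cases hβ : β ∈ U
        · rw [restr_vertex_of_notMem (not_not.2 hβ), lie_zero]
        · rw [restr_vertex_of_mem (U := Uᶜ) hβ, lie_vertex fun h => hβ (hU _ _ h hα)]
      · rw [map_zero, lie_zero]
      · rw [map_add, lie_add, hx, hy, add_zero]
      · rw [map_smul, lie_smul, hx, smul_zero]
      · rw [LieHom.map_lie, leibniz_lie, hx, hy, zero_lie, lie_zero, add_zero]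
    · rw [restr_vertex_of_notMem hα, zero_lie]
  refine induction_on (P := fun x => ⁅restr K G c U x, restr K G c Uᶜ y⁆ = 0) x
    (fun β => h1 β y) ?_ (fun x y hx hy => ?_) (fun l x hx => ?_)
    (fun x y hx hy => ?_)
  · rw [map_zero, zero_lie]
  · rw [map_add, add_lie, hx, hy, add_zero]
  · rw [map_smul, smul_lie, hx, smul_zero]
  · rw [LieHom.map_lie, lie_lie, hx, hy, lie_zero, lie_zero, sub_zero]

/-- If `U` is a union of connected components, the Lie algebra is the sum of the parts over `U` and
over its complement. -/
theorem restr_add_restr_compl {U : Set S} (hU : ∀ α β, G.Adj α β → α ∈ U → β ∈ U)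
    (x : NilLieAlg K G c) : restr K G c U x + restr K G c Uᶜ x = x := by
  refine induction_on (P := fun x => restr K G c U x + restr K G c Uᶜ x = x) x (fun β => ?_) ?_
    (fun x y hx hy => ?_) (fun l x hx => ?_) (fun x y hx hy => ?_)
  · by_cases hβ : β ∈ U
    · rw [restr_vertex_of_mem hβ, restr_vertex_of_notMem (not_not.2 hβ), add_zero]
    · rw [restr_vertex_of_notMem hβ, restr_vertex_of_mem (U := Uᶜ) hβ, zero_add]
  · rw [map_zero, map_zero, add_zero]
  · rw [map_add, map_add, add_add_add_comm, hx, hy]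
  · rw [map_smul, map_smul, ← smul_add, hx]
  -- Both factors are split on the right-hand side only. The mixed brackets vanish, leaving the two
  -- pure ones.
  · conv_rhs => rw [← hx, ← hy]
    rw [add_lie, lie_add, lie_add, lie_restr_restr_compl hU, ← lie_skew (restr K G c Uᶜ x),
      lie_restr_restr_compl hU, LieHom.map_lie, LieHom.map_lie]
    simp

end Restriction

end Coordinates


/-! ### Splittings and connected components -/

section Components

variable {S : Type u} {G : SimpleGraph S}

/-- A splitting is compatible with the action on the connected components. -/
theorem IsSplitting.chi_connectedComponentMk {r : AutQuot G →* (G ≃g G)} (hr : IsSplitting G r)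
    (φ : AutQuot G) (α : S) :
    chi G φ (G.connectedComponentMk α) = G.connectedComponentMk (r φ α) := by
  change chiFun φ (G.connectedComponentMk α) = _
  by_cases hC : (G.connectedComponentMk α).supp.Subsingleton
  · have h1 : ∀ γ, ¬ G.Adj α γ := fun γ h => not_subsingleton_of_adj h hC
    have h2 : ∀ γ, ¬ G.Adj (r φ α) γ := fun γ h =>
      h1 ((r φ).symm γ) ((r φ).map_adj_iff.1 (by rwa [RelIso.apply_symm_apply]))
    have h3 : cohMk G (r φ α) = cohMk G α :=
      (cohMk_eq_iff G).2 ⟨fun γ h => (h2 γ h).elim, fun γ h => (h1 γ h).elim⟩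
    rw [hr.2 φ α ((hr.1 φ α).symm.trans h3), chiFun_of_subsingleton φ hC]
  · exact chiFun_eq φ hC rfl (hr.1 φ α)

end Components

/-! ### The twisted Galois action and descent -/

section Form

variable {K : Type w} {L : Type v} [Field K] [Field L] [Algebra K L] {S : Type u}
  {G : SimpleGraph S} {c : ℕ}

theorem coord_galAct [NeZero c] (σ : Gal(L/K)) (α : S) (x : NilLieAlg L G c) :
    coord L G c α (galAct G c σ x) = σ (coord L G c α x) := by
  refine induction_on (P := fun x => coord L G c α (galAct G c σ x) = σ (coord L G c α x)) x
    (fun β => ?_) ?_ (fun x y hx hy => ?_) (fun l x hx => ?_) (fun x y hx hy => ?_)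
  · rw [galAct_vertex, coord_vertex]
    split_ifs <;> simp
  · rw [galAct_zero, map_zero, map_zero]
  · rw [galAct_add, map_add, map_add, map_add, hx, hy]
  · rw [galAct_smul, map_smul, map_smul, hx, smul_eq_mul, smul_eq_mul, map_mul]
  · rw [galAct_lie, coord_lie, coord_lie, map_zero]

variable (r : AutQuot G →* (G ≃g G)) (ρ : Gal(L/K) →* AutQuot G)

variable (c) in
/-- The semilinear action whose fixed points are the form. -/
def twistedAct (σ : Gal(L/K)) : NilLieAlg L G c →+ NilLieAlg L G c where
  toFun x := permHom L c (r (ρ σ)) (galAct G c σ x)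
  map_zero' := by rw [galAct_zero, map_zero]
  map_add' x y := by rw [galAct_add, map_add]

variable {r ρ}

theorem twistedAct_vertex (σ : Gal(L/K)) (α : S) :
    twistedAct c r ρ σ (vertex L G c α) = vertex L G c (r (ρ σ) α) := by
  change permHom L c (r (ρ σ)) (galAct G c σ (vertex L G c α)) = _
  rw [galAct_vertex, permHom_vertex]

theorem twistedAct_smul (σ : Gal(L/K)) (l : L) (x : NilLieAlg L G c) :
    twistedAct c r ρ σ (l • x) = σ l • twistedAct c r ρ σ x := by
  change permHom L c (r (ρ σ)) (galAct G c σ (l • x)) = _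
  rw [galAct_smul, map_smul]
  rfl

theorem twistedAct_lie (σ : Gal(L/K)) (x y : NilLieAlg L G c) :
    twistedAct c r ρ σ ⁅x, y⁆ = ⁅twistedAct c r ρ σ x, twistedAct c r ρ σ y⁆ := by
  change permHom L c (r (ρ σ)) (galAct G c σ ⁅x, y⁆) = _
  rw [galAct_lie, LieHom.map_lie]
  rfl

theorem coord_twistedAct [NeZero c] (σ : Gal(L/K)) (α : S) (x : NilLieAlg L G c) :
    coord L G c (r (ρ σ) α) (twistedAct c r ρ σ x) = σ (coord L G c α x) :=
  (coord_permHom (r (ρ σ)) α _).trans (coord_galAct σ α x)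

theorem mem_form_iff {x : NilLieAlg L G c} :
    (show RestrictScalars K L (NilLieAlg L G c) from x) ∈ form K r ρ c ↔
      ∀ σ, twistedAct c r ρ σ x = x := Iff.rfl

/-- Elements of the Galois group with the same image under `ρ` agree on the fixed field of the
kernel of `ρ`. -/
theorem apply_eq_of_mem_fixedField {σ τ : Gal(L/K)} (h : ρ σ = ρ τ) {x : L}
    (hx : x ∈ IntermediateField.fixedField ρ.ker) : σ x = τ x := by
  have h1 : τ⁻¹ * σ ∈ ρ.ker := by rw [MonoidHom.mem_ker, map_mul, map_inv, h, inv_mul_cancel]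
  have h2 : (τ⁻¹ * σ) x = x := (IntermediateField.mem_fixedField_iff _ x).1 hx _ h1
  rw [AlgEquiv.mul_apply] at h2
  conv_rhs => rw [← h2]
  exact (AlgEquiv.apply_symm_apply τ (σ x)).symm

/-- The converse of `apply_eq_of_mem_fixedField`, for continuous `ρ`. -/
theorem eq_of_apply_eq_on_fixedField [IsGalois K L] (hρ : Continuous[krullTopology K L, ⊥] ρ)
    {σ τ : Gal(L/K)} (h : ∀ x ∈ IntermediateField.fixedField ρ.ker, σ x = τ x) : ρ σ = ρ τ := by
  -- Continuity into a discrete group makes the kernel closed, so infinite Galois theory recovers it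
  -- from its fixed field.
  let H : ClosedSubgroup Gal(L/K) :=
    { ρ.ker with
      isClosed' := @IsClosed.preimage _ _ (krullTopology K L) ⊥ ρ hρ {1}
        (@isClosed_discrete _ ⊥ (@DiscreteTopology.mk _ ⊥ rfl) _) }
  have hF : (IntermediateField.fixedField ρ.ker).fixingSubgroup = ρ.ker :=
    InfiniteGalois.fixingSubgroup_fixedField H
  have h1 : τ⁻¹ * σ ∈ (IntermediateField.fixedField ρ.ker).fixingSubgroup := by
    rw [IntermediateField.mem_fixingSubgroup_iff]
    intro x hx
    rw [AlgEquiv.mul_apply, h x hx]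
    exact AlgEquiv.symm_apply_apply τ x
  rw [hF, MonoidHom.mem_ker, map_mul, map_inv, inv_mul_eq_one] at h1
  exact h1.symm

/-- For `x` in the fixed field `F` of the kernel of `ρ`, the sum `t x` over the finite image of `ρ`
is a fixed vector. A linear form vanishing on all fixed vectors but not at the vertex would give a
nontrivial linear relation between distinct embeddings of `F` in `L`, against Dedekind's theorem. -/
theorem vertex_mem_span_form [Finite S] [IsGalois K L] (hρ : Continuous[krullTopology K L, ⊥] ρ)
    (α : S) :
    vertex L G c α ∈
      Submodule.span L {x : NilLieAlg L G c | ∀ σ, twistedAct c r ρ σ x = x} := by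
  have : Finite (CohComp G) := Finite.of_surjective _ (cohMk_surjective G)
  have := Fintype.ofFinite ρ.range
  let F : IntermediateField K L := IntermediateField.fixedField ρ.ker
  -- Any choice of preimages will do: two preimages of the same element agree on `F`.
  let s : ρ.range → Gal(L/K) := fun g => g.2.choose
  have hs : ∀ g, ρ (s g) = g := fun g => g.2.choose_spec
  let t : L → NilLieAlg L G c := fun x => ∑ g, s g x • vertex L G c (r g α)
  have ht : ∀ x ∈ F, ∀ σ, twistedAct c r ρ σ (t x) = t x := by
    intro x hx σ
    rw [map_sum]
    refine Fintype.sum_equiv (Equiv.mulLeft (⟨ρ σ, σ, rfl⟩ : ρ.range)) _ _ fun g => ?_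
    rw [twistedAct_smul, twistedAct_vertex]
    congr 1
    · refine apply_eq_of_mem_fixedField (σ := σ * s g) ?_ hx
      rw [hs, map_mul, hs]
      rfl
    · rw [Equiv.coe_mulLeft, Subgroup.coe_mul, map_mul]
      rfl
  by_contra hα
  obtain ⟨f, hfα, hf⟩ := Submodule.exists_le_ker_of_notMem hα
  let X : ρ.range → F →* L := fun g => ((s g : L →+* L).comp (algebraMap F L) : F →+* L)
  have hX : Function.Injective X := fun g g' h => Subtype.ext (by
    rw [← hs g, ← hs g']
    exact eq_of_apply_eq_on_fixedField hρ fun x hx => DFunLike.congr_fun h (⟨x, hx⟩ : F))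
  have hli := Fintype.linearIndependent_iff.1 ((linearIndependent_monoidHom F L).comp X hX)
    (fun g => f (vertex L G c (r g α))) (by
      ext x
      have h1 : f (t x) = 0 := hf (Submodule.subset_span (ht x x.2))
      rw [map_sum] at h1
      rw [Finset.sum_apply, Pi.zero_apply, ← h1]
      refine Finset.sum_congr rfl fun g _ => ?_
      rw [map_smul, smul_eq_mul, mul_comm]
      rfl)
  refine hfα ?_
  have := hli 1
  rwa [OneMemClass.coe_one, map_one] at this

/-- The vectors of the form span the Lie algebra over the big field. -/
theorem mem_span_form [Finite S] [IsGalois K L] (hρ : Continuous[krullTopology K L, ⊥] ρ)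
    (x : NilLieAlg L G c) :
    x ∈ Submodule.span L {x : NilLieAlg L G c | ∀ σ, twistedAct c r ρ σ x = x} := by
  refine induction_on x (fun α => vertex_mem_span_form hρ α) (Submodule.zero_mem _)
    (fun x y => Submodule.add_mem _) (fun l x => Submodule.smul_mem _ l) (fun x y hx hy => ?_)
  induction hx, hy using Submodule.span_induction₂ with
  | mem_mem x y hx hy =>
    exact Submodule.subset_span fun σ => by rw [twistedAct_lie, hx σ, hy σ]
  | zero_left y _ => rw [zero_lie]; exact Submodule.zero_mem _
  | zero_right x _ => rw [lie_zero]; exact Submodule.zero_mem _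
  | add_left x y z _ _ _ h1 h2 => rw [add_lie]; exact Submodule.add_mem _ h1 h2
  | add_right x y z _ _ _ h1 h2 => rw [lie_add]; exact Submodule.add_mem _ h1 h2
  | smul_left l x y _ _ h => rw [smul_lie]; exact Submodule.smul_mem _ l h
  | smul_right l x y _ _ h => rw [lie_smul]; exact Submodule.smul_mem _ l h

/-- A linear form on the Lie algebra that vanishes on the form is zero. -/
theorem linearMap_eq_zero [Finite S] [IsGalois K L] (hρ : Continuous[krullTopology K L, ⊥] ρ)
    (f : NilLieAlg L G c →ₗ[L] L)
    (hf : ∀ x, (∀ σ, twistedAct c r ρ σ x = x) → f x = 0) (x : NilLieAlg L G c) : f x = 0 := by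
  have h : Submodule.span L {x : NilLieAlg L G c | ∀ σ, twistedAct c r ρ σ x = x} ≤ f.ker :=
    Submodule.span_le.2 hf
  exact h (mem_span_form hρ x)

/-- Galois descent for subspaces of the form. -/
theorem mem_of_mem_span_of_fixed [IsGalois K L] [CharZero K]
    (J : AddSubgroup (NilLieAlg L G c)) (hJ' : ∀ (k : K), ∀ x ∈ J, algebraMap K L k • x ∈ J)
    (hJ : ∀ x ∈ J, ∀ σ, twistedAct c r ρ σ x = x)
    {x : NilLieAlg L G c} (hx : x ∈ Submodule.span L (J : Set (NilLieAlg L G c)))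
    (hx' : ∀ σ, twistedAct c r ρ σ x = x) : x ∈ J := by
  obtain ⟨n, f, g, rfl⟩ := Submodule.mem_span_set'.1 hx
  -- The finitely many coefficients lie in a finite Galois extension of `K`, whose automorphisms are
  -- lifted to `L`.
  let F := FiniteGaloisIntermediateField.adjoin K (Set.range f)
  have hfF : ∀ i, f i ∈ F.toIntermediateField := fun i =>
    FiniteGaloisIntermediateField.subset_adjoin K _ ⟨i, rfl⟩
  let e : Gal(F/K) → Gal(L/K) := Function.surjInv (AlgEquiv.restrictNormalHom_surjective L)
  have he : ∀ (τ : Gal(F/K)) (y : F), e τ (y : L) = (τ y : F) := fun τ y => by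
    have h := AlgEquiv.restrictNormal_commutes (e τ) F y
    have h' : AlgEquiv.restrictNormalHom F (e τ) = τ :=
      Function.surjInv_eq (AlgEquiv.restrictNormalHom_surjective L) τ
    exact h.symm.trans (congrArg (fun θ : Gal(F/K) => ((θ y : F) : L)) h')
  have hsum : ∀ i, ∑ τ : Gal(F/K), e τ (f i) =
      algebraMap K L (Algebra.trace K F ⟨f i, hfF i⟩) := fun i => by
    rw [IsScalarTower.algebraMap_apply K F L, trace_eq_sum_automorphisms, map_sum]
    exact Finset.sum_congr rfl fun τ _ => he τ ⟨f i, hfF i⟩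
  -- Summing the twisted action over the lifts multiplies the fixed vector by the order of the group
  -- and replaces every coefficient by its trace, which lies in `K`. Characteristic zero allows
  -- division by the order.
  have h1 : (Fintype.card Gal(F/K) : L) • ∑ i, f i • (g i : NilLieAlg L G c) =
      ∑ i, algebraMap K L (Algebra.trace K F ⟨f i, hfF i⟩) • (g i : NilLieAlg L G c) := by
    calc _ = ∑ τ : Gal(F/K), twistedAct c r ρ (e τ) (∑ i, f i • (g i : NilLieAlg L G c)) := by
          simp only [hx', Finset.sum_const, Finset.card_univ, Nat.cast_smul_eq_nsmul]
      _ = ∑ τ : Gal(F/K), ∑ i, e τ (f i) • (g i : NilLieAlg L G c) := by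
          refine Finset.sum_congr rfl fun τ _ => ?_
          rw [map_sum]
          refine Finset.sum_congr rfl fun i _ => ?_
          rw [twistedAct_smul, hJ _ (g i).2]
      _ = _ := by
          rw [Finset.sum_comm]
          refine Finset.sum_congr rfl fun i _ => ?_
          rw [← Finset.sum_smul, hsum]
  have hN : (Fintype.card Gal(F/K) : K) ≠ 0 := Nat.cast_ne_zero.2 Fintype.card_ne_zero
  have h2 : (∑ i, f i • (g i : NilLieAlg L G c)) =
      algebraMap K L ((Fintype.card Gal(F/K) : K)⁻¹) •
        ∑ i, algebraMap K L (Algebra.trace K F ⟨f i, hfF i⟩) • (g i : NilLieAlg L G c) := by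
    rw [← h1, smul_smul, ← map_natCast (algebraMap K L), ← map_mul, inv_mul_cancel₀ hN, map_one,
      one_smul]
  rw [h2]
  exact hJ' _ _ (J.sum_mem fun i _ => hJ' _ _ (g i).2)

end Form


/-! ### Ideals of the form inside the Lie algebra over the large field -/

section Ideals

variable {K : Type w} {L : Type v} [Field K] [Field L] [Algebra K L] {S : Type u}
  {G : SimpleGraph S} {c : ℕ} {r : AutQuot G →* (G ≃g G)} {ρ : Gal(L/K) →* AutQuot G}

/-- An ideal of the form, as a subgroup of the Lie algebra over the big field. -/
def idealSubgroup (I : LieIdeal K (form K r ρ c)) : AddSubgroup (NilLieAlg L G c) where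
  carrier := {x | ∃ h : ∀ σ, twistedAct c r ρ σ x = x, (⟨x, h⟩ : form K r ρ c) ∈ I}
  zero_mem' := ⟨fun _ => map_zero _, I.zero_mem⟩
  add_mem' := fun ⟨_, h₁⟩ ⟨_, h₂⟩ => ⟨_, I.add_mem h₁ h₂⟩
  neg_mem' := fun ⟨_, h⟩ => ⟨_, neg_mem h⟩

variable {I J : LieIdeal K (form K r ρ c)} {x y : NilLieAlg L G c}

theorem mem_idealSubgroup_of_mem {p : form K r ρ c} (hp : p ∈ I) :
    (show NilLieAlg L G c from p.1) ∈ idealSubgroup I := ⟨p.2, hp⟩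

theorem smul_mem_idealSubgroup (k : K) (hx : x ∈ idealSubgroup I) :
    algebraMap K L k • x ∈ idealSubgroup I :=
  let ⟨_, h⟩ := hx
  ⟨_, SMulMemClass.smul_mem k h⟩

theorem twistedAct_of_mem (hx : x ∈ idealSubgroup I) (σ : Gal(L/K)) :
    twistedAct c r ρ σ x = x := hx.1 σ

theorem lie_mem_idealSubgroup (hx : ∀ σ, twistedAct c r ρ σ x = x) (hy : y ∈ idealSubgroup I) :
    ⁅x, y⁆ ∈ idealSubgroup I :=
  let ⟨_, h⟩ := hy
  ⟨_, lie_mem_right K (form K r ρ c) I ⟨x, hx⟩ _ h⟩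

theorem eq_zero_of_mem_of_mem (hIJ : Disjoint I J) (hx : x ∈ idealSubgroup I)
    (hx' : x ∈ idealSubgroup J) : x = 0 := by
  have h : (⟨x, hx.1⟩ : form K r ρ c) ∈ I ⊓ J := ⟨hx.2, hx'.2⟩
  rw [hIJ.eq_bot, LieSubmodule.mem_bot] at h
  exact congrArg Subtype.val h

theorem exists_add_of_codisjoint (hIJ : Codisjoint I J) (hx : ∀ σ, twistedAct c r ρ σ x = x) :
    ∃ p ∈ idealSubgroup I, ∃ q ∈ idealSubgroup J, x = p + q := by
  have h : (⟨x, hx⟩ : form K r ρ c) ∈ I ⊔ J := hIJ.eq_top ▸ LieSubmodule.mem_top _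
  obtain ⟨p, hp, q, hq, h⟩ := (LieSubmodule.mem_sup I J _).1 h
  exact ⟨_, mem_idealSubgroup_of_mem hp, _, mem_idealSubgroup_of_mem hq,
    (congrArg Subtype.val h).symm⟩

/-- The bracket lies in both ideals. -/
theorem lie_eq_zero_of_disjoint (hIJ : Disjoint I J) (hx : x ∈ idealSubgroup I)
    (hy : y ∈ idealSubgroup J) : ⁅x, y⁆ = 0 :=
  eq_zero_of_mem_of_mem hIJ
    (by rw [← lie_skew]; exact neg_mem (lie_mem_idealSubgroup hy.1 hx))
    (lie_mem_idealSubgroup hx.1 hy)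

theorem eq_bot_of_forall_eq_zero (h : ∀ x ∈ idealSubgroup I, x = 0) : I = ⊥ :=
  (LieSubmodule.eq_bot_iff I).2 fun _ hp => Subtype.ext (h _ (mem_idealSubgroup_of_mem hp))

theorem mem_idealSubgroup_of_mem_span [IsGalois K L] [CharZero K]
    (hx : x ∈ Submodule.span L (idealSubgroup I : Set (NilLieAlg L G c)))
    (hx' : ∀ σ, twistedAct c r ρ σ x = x) : x ∈ idealSubgroup I :=
  mem_of_mem_span_of_fixed _ (fun k _ => smul_mem_idealSubgroup k)
    (fun _ => twistedAct_of_mem) hx hx'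

/-! ### A direct sum decomposition from a union of orbits of connected components -/

theorem twistedAct_restr {U : Set S} (hU : ∀ σ α, r (ρ σ) α ∈ U ↔ α ∈ U) (σ : Gal(L/K))
    (x : NilLieAlg L G c) :
    twistedAct c r ρ σ (restr L G c U x) = restr L G c U (twistedAct c r ρ σ x) := by
  refine induction_on (P := fun x => twistedAct c r ρ σ (restr L G c U x) =
    restr L G c U (twistedAct c r ρ σ x)) x (fun α => ?_) ?_ (fun x y hx hy => ?_)
    (fun l x hx => ?_) (fun x y hx hy => ?_)
  · rw [twistedAct_vertex]
    by_cases hα : α ∈ U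
    · rw [restr_vertex_of_mem hα, restr_vertex_of_mem ((hU σ α).2 hα), twistedAct_vertex]
    · rw [restr_vertex_of_notMem hα, restr_vertex_of_notMem (mt (hU σ α).1 hα), map_zero]
  · simp only [map_zero]
  · simp only [map_add, hx, hy]
  · simp only [map_smul, twistedAct_smul, hx]
  · simp only [LieHom.map_lie, twistedAct_lie, hx, hy]

variable (K r ρ c) in
/-- The ideal of the form of all elements killed by the restriction to a set of vertices. -/
def restrKer (U : Set S) : LieIdeal K (form K r ρ c) where
  carrier := {p | restr L G c U (show NilLieAlg L G c from p.1) = 0}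
  zero_mem' := map_zero (restr L G c U)
  add_mem' := fun {p q} hp hq => by
    change restr L G c U ((p.1 : NilLieAlg L G c) + (q.1 : NilLieAlg L G c)) = 0
    exact (map_add (restr L G c U) _ _).trans (by rw [hp, hq, add_zero])
  smul_mem' := fun k p hp =>
    (map_smul (restr L G c U) (algebraMap K L k) _).trans (by rw [hp, smul_zero])
  lie_mem := fun {p q} hq =>
    (LieHom.map_lie (restr L G c U) _ _).trans (by rw [hq, lie_zero])

theorem mem_restrKer {U : Set S} (hx : ∀ σ, twistedAct c r ρ σ x = x) :
    (⟨x, hx⟩ : form K r ρ c) ∈ restrKer K c r ρ U ↔ restr L G c U x = 0 := Iff.rfl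

/-- The witness is the sum of the vertices in the Galois orbit of some `α` in `U`. It is fixed
because the action permutes the orbit, it is supported in `U`, and its coordinate at `α` is 1. -/
theorem restrKer_compl_ne_bot [Finite S] [NeZero c] {U : Set S}
    (hU : ∀ σ α, r (ρ σ) α ∈ U ↔ α ∈ U) (hne : U.Nonempty) : restrKer K c r ρ Uᶜ ≠ ⊥ := by
  classical
  have := Fintype.ofFinite S
  obtain ⟨α, hα⟩ := hne
  let O : Finset S := Finset.univ.filter fun β => ∃ σ, r (ρ σ) α = β
  have hO : ∀ σ β, β ∈ O ↔ r (ρ σ) β ∈ O := by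
    intro σ β
    simp only [O, Finset.mem_filter, Finset.mem_univ, true_and]
    constructor
    · rintro ⟨τ, rfl⟩
      exact ⟨σ * τ, by rw [map_mul, map_mul]; rfl⟩
    · rintro ⟨τ, h⟩
      refine ⟨σ⁻¹ * τ, ?_⟩
      rw [map_mul, map_mul, RelIso.mul_apply, h, ← RelIso.mul_apply, ← map_mul, ← map_mul,
        inv_mul_cancel, map_one, map_one]
      rfl
  let x : NilLieAlg L G c := ∑ β ∈ O, vertex L G c β
  have hx : ∀ σ, twistedAct c r ρ σ x = x := by
    intro σ
    rw [map_sum]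
    exact Finset.sum_equiv (r (ρ σ)).toEquiv (hO σ) fun β _ => twistedAct_vertex σ β
  have hxU : restr L G c Uᶜ x = 0 := by
    rw [map_sum]
    refine Finset.sum_eq_zero fun β hβ => restr_vertex_of_notMem (not_not.2 ?_)
    obtain ⟨σ, rfl⟩ := (Finset.mem_filter.1 hβ).2
    exact (hU σ α).2 hα
  have hx0 : coord L G c α x = 1 := by
    rw [map_sum, Finset.sum_eq_single α (fun β _ hβ => coord_vertex_of_ne hβ), coord_vertex_self]
    exact fun h => (h (Finset.mem_filter.2 ⟨Finset.mem_univ _, 1, by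
      rw [map_one, map_one]; rfl⟩)).elim
  intro hbot
  have h := (mem_restrKer hx).2 hxU
  rw [hbot, LieSubmodule.mem_bot] at h
  have h' : x = 0 := congrArg Subtype.val h
  rw [h', map_zero] at hx0
  exact zero_ne_one hx0

/-- The restrictions to `U` and to its complement add up to the identity and commute with the
twisted action, so every fixed vector splits into fixed vectors. The part over `U` appears as the
kernel of the restriction to the complement. -/
theorem isDecomposable_of_invariant [Finite S] [NeZero c] {U : Set S}
    (hUadj : ∀ α β, G.Adj α β → α ∈ U → β ∈ U) (hU : ∀ σ α, r (ρ σ) α ∈ U ↔ α ∈ U)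
    (hne : U.Nonempty) (hne' : Uᶜ.Nonempty) : IsDecomposable K (form K r ρ c) := by
  have hU' : ∀ σ α, r (ρ σ) α ∈ Uᶜ ↔ α ∈ Uᶜ := fun σ α => not_congr (hU σ α)
  refine ⟨restrKer K c r ρ Uᶜ, restrKer K c r ρ U, restrKer_compl_ne_bot hU hne, ?_, ?_, ?_⟩
  · have := restrKer_compl_ne_bot (K := K) (L := L) (c := c) hU' hne'
    rwa [compl_compl] at this
  · rw [disjoint_iff, LieSubmodule.eq_bot_iff]
    rintro ⟨x, hx⟩ ⟨h1, h2⟩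
    refine Subtype.ext ?_
    have h3 := restr_add_restr_compl hUadj (show NilLieAlg L G c from x)
    rw [(mem_restrKer hx).1 h1, (mem_restrKer hx).1 h2, add_zero] at h3
    exact h3.symm
  · rw [codisjoint_iff, eq_top_iff]
    rintro ⟨(x : NilLieAlg L G c), hx⟩ -
    have h1 : ∀ σ, twistedAct c r ρ σ (restr L G c U x) = restr L G c U x := fun σ => by
      rw [twistedAct_restr hU, mem_form_iff.1 hx]
    have h2 : ∀ σ, twistedAct c r ρ σ (restr L G c Uᶜ x) = restr L G c Uᶜ x := fun σ => by
      rw [twistedAct_restr hU', mem_form_iff.1 hx]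
    refine (LieSubmodule.mem_sup _ _ _).2 ⟨⟨_, h1⟩, ?_, ⟨_, h2⟩, ?_, ?_⟩
    · refine (mem_restrKer h1).2 ?_
      have := restr_restr_compl (K := L) (G := G) (c := c) Uᶜ x
      rwa [compl_compl] at this
    · exact (mem_restrKer h2).2 (restr_restr_compl U x)
    · exact Subtype.ext (restr_add_restr_compl hUadj (show NilLieAlg L G c from x))

/-! ### Indecomposability -/

/-- Elements of the form are fixed, so their coordinate at the moved vertex is the `σ`-conjugate of
the one at `α`. -/
theorem coord_eq_zero_of_invariant [NeZero c] {α : S}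
    (h : ∀ x ∈ idealSubgroup I, coord L G c α x = 0)
    (σ : Gal(L/K)) (hx : x ∈ idealSubgroup I) : coord L G c (r (ρ σ) α) x = 0 := by
  rw [← twistedAct_of_mem hx σ, coord_twistedAct, h x hx, map_zero]

theorem eq_coord_smul_vertex [NeZero c] [Subsingleton S] (α : S) (x : NilLieAlg L G c) :
    x = coord L G c α x • vertex L G c α := by
  refine induction_on (P := fun x => x = coord L G c α x • vertex L G c α) x (fun β => ?_) ?_
    (fun x y hx hy => ?_) (fun l x hx => ?_) (fun x y hx hy => ?_)
  · rw [Subsingleton.elim β α, coord_vertex_self, one_smul]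
  · rw [map_zero, zero_smul]
  · rw [map_add, add_smul, ← hx, ← hy]
  · rw [map_smul, smul_eq_mul, mul_smul, ← hx]
  · rw [coord_lie, zero_smul, hx, hy, smul_lie, lie_smul, lie_self, smul_zero, smul_zero]

variable [Finite S] [IsGalois K L] [NeZero c]

/-- A direct summand of the form whose elements have no linear part is zero. -/
theorem eq_bot_of_coord_eq_zero [CharZero K] (hρ : Continuous[krullTopology K L, ⊥] ρ)
    (hIJ : IsCompl I J) (hI : ∀ x ∈ idealSubgroup I, ∀ α, coord L G c α x = 0) : I = ⊥ := by
  -- The `L`-span of `J` is an ideal of the whole algebra because the form spans that algebra over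
  -- `L`.
  let Q : LieIdeal L (NilLieAlg L G c) :=
    { Submodule.span L (idealSubgroup J : Set (NilLieAlg L G c)) with
      lie_mem := fun {x y} hy => by
        have hx := mem_span_form (r := r) hρ x
        replace hy : y ∈ Submodule.span L (idealSubgroup J : Set (NilLieAlg L G c)) := hy
        change ⁅x, y⁆ ∈ Submodule.span L (idealSubgroup J : Set (NilLieAlg L G c))
        induction hx, hy using Submodule.span_induction₂ with
        | mem_mem x y hx hy => exact Submodule.subset_span (lie_mem_idealSubgroup hx hy)
        | zero_left y _ => rw [zero_lie]; exact Submodule.zero_mem _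
        | zero_right x _ => rw [lie_zero]; exact Submodule.zero_mem _
        | add_left x y z _ _ _ h1 h2 => rw [add_lie]; exact Submodule.add_mem _ h1 h2
        | add_right x y z _ _ _ h1 h2 => rw [lie_add]; exact Submodule.add_mem _ h1 h2
        | smul_left l x y _ _ h => rw [smul_lie]; exact Submodule.smul_mem _ l h
        | smul_right l x y _ _ h => rw [lie_smul]; exact Submodule.smul_mem _ l h }
  have hQ : Q = ⊤ := by
    -- The summand `I` lies in the derived algebra, so `J` alone spans modulo brackets.
    refine eq_top_of_sup_eq_top Q (eq_top_iff.2 fun x hx => ?_)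
    clear hx
    induction mem_span_form (r := r) hρ x using Submodule.span_induction with
    | mem x hx =>
      obtain ⟨p, hp, q, hq, rfl⟩ := exists_add_of_codisjoint hIJ.codisjoint hx
      rw [add_comm p q]
      exact (LieSubmodule.mem_sup _ _ _).2 ⟨q, Submodule.subset_span hq, p,
        mem_lowerCentralSeries_one (hI p hp), rfl⟩
    | zero => exact LieSubmodule.zero_mem _
    | add x y _ _ hx hy => exact add_mem hx hy
    | smul l x _ hx => exact SMulMemClass.smul_mem l hx
  refine eq_bot_of_forall_eq_zero fun x hx => eq_zero_of_mem_of_mem hIJ.disjoint hx ?_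
  have hxQ : x ∈ Q := hQ ▸ LieSubmodule.mem_top x
  exact mem_idealSubgroup_of_mem_span hxQ (twistedAct_of_mem hx)

/-- The coordinates at the ends of an edge vanish on one of two complementary ideals. -/
theorem coord_eq_zero_or_of_adj (hc : 2 ≤ c) (hρ : Continuous[krullTopology K L, ⊥] ρ)
    (hIJ : IsCompl I J) {α β : S} (h : G.Adj α β) :
    (∀ x ∈ idealSubgroup I, coord L G c α x = 0 ∧ coord L G c β x = 0) ∨
      ∀ x ∈ idealSubgroup J, coord L G c α x = 0 ∧ coord L G c β x = 0 := by
  by_contra! hne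
  obtain ⟨⟨p, hp, hp'⟩, q, hq, hq'⟩ := hne
  have hprop : ∀ x ∈ idealSubgroup I, ∀ y ∈ idealSubgroup J,
      coord L G c α x * coord L G c β y = coord L G c β x * coord L G c α y := fun x hx y hy =>
    coord_mul_coord_eq_of_lie_eq_zero hc h (lie_eq_zero_of_disjoint hIJ.disjoint hx hy)
  -- This is the determinant against the pair of `q`. It vanishes on `I` by proportionality with
  -- `q`, and on `J` because all pairs there, including that of `q`, are proportional to the nonzero
  -- pair of `p`. Being zero on the form it is zero everywhere, and its values at the two vertices
  -- show that the pair of `q` is zero.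
  let f : NilLieAlg L G c →ₗ[L] L :=
    coord L G c α q • (coord L G c β : NilLieAlg L G c →ₗ[L] L) -
      coord L G c β q • (coord L G c α : NilLieAlg L G c →ₗ[L] L)
  have hf : ∀ x, f x = coord L G c α q * coord L G c β x - coord L G c β q * coord L G c α x :=
    fun _ => rfl
  have hfI : ∀ x ∈ idealSubgroup I, f x = 0 := fun x hx => by
    rw [hf]
    linear_combination -hprop x hx q hq
  have hfJ : ∀ x ∈ idealSubgroup J, f x = 0 := fun x hx => by
    rw [hf]
    have h1 := hprop p hp q hq
    have h2 := hprop p hp x hx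
    by_cases hα : coord L G c α p = 0
    · have hβ := hp' hα
      rw [hα, zero_mul, eq_comm, mul_eq_zero, or_iff_right hβ] at h1 h2
      rw [h1, h2, zero_mul, mul_zero, sub_zero]
    · refine mul_left_cancel₀ hα ?_
      linear_combination coord L G c α q * h2 - coord L G c α x * h1
  have hf0 := linearMap_eq_zero hρ f fun x hx => by
    obtain ⟨y, hy, z, hz, rfl⟩ := exists_add_of_codisjoint hIJ.codisjoint hx
    rw [map_add, hfI y hy, hfJ z hz, add_zero]
  have h1 := hf0 (vertex L G c α)
  have h2 := hf0 (vertex L G c β)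
  rw [hf, coord_vertex_self, coord_vertex_of_ne h.ne] at h1
  rw [hf, coord_vertex_self, coord_vertex_of_ne h.ne'] at h2
  simp only [mul_zero, mul_one, sub_zero, zero_sub, neg_eq_zero] at h1 h2
  exact hq' h2 h1

/-- The vanishing of a coordinate on a direct summand propagates along paths. -/
theorem coord_eq_zero_of_reachable (hc : 2 ≤ c) (hρ : Continuous[krullTopology K L, ⊥] ρ)
    (hIJ : IsCompl I J) {α β : S} (h : G.Reachable α β)
    (hα : ∀ x ∈ idealSubgroup I, coord L G c α x = 0) :
    ∀ x ∈ idealSubgroup I, coord L G c β x = 0 := by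
  obtain ⟨p⟩ := h
  induction p with
  | nil => exact hα
  | @cons a b d hab _ ih =>
    refine ih ?_
    rcases coord_eq_zero_or_of_adj hc hρ hIJ hab with h | h
    · exact fun x hx => (h x hx).2
    -- Otherwise the coordinate at `a` vanishes on both summands, hence everywhere, although it is 1
    -- at the vertex `a`.
    · have h0 := linearMap_eq_zero hρ (coord L G c a : NilLieAlg L G c →ₗ[L] L) fun x hx => by
        obtain ⟨y, hy, z, hz, rfl⟩ := exists_add_of_codisjoint hIJ.codisjoint hx
        rw [map_add]
        change coord L G c a y + coord L G c a z = 0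
        rw [hα y hy, (h z hz).1, add_zero]
      exact absurd ((coord_vertex_self a).symm.trans (h0 (vertex L G c a))) one_ne_zero

/-- A single vanishing coordinate suffices: a Galois element carries `α` into the component of any
given `β`, and a path leads from there to `β`. -/
theorem eq_bot_of_coord_eq_zero_of_transitive [CharZero K] (hr : IsSplitting G r) (hc : 2 ≤ c)
    (hρ : Continuous[krullTopology K L, ⊥] ρ)
    (htrans : ∀ C D : G.ConnectedComponent, ∃ σ : Gal(L/K), chi G (ρ σ) C = D)
    (hIJ : IsCompl I J) {α : S} (hα : ∀ x ∈ idealSubgroup I, coord L G c α x = 0) : I = ⊥ := by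
  refine eq_bot_of_coord_eq_zero hρ hIJ fun x hx β => ?_
  obtain ⟨σ, hσ⟩ := htrans (G.connectedComponentMk α) (G.connectedComponentMk β)
  rw [hr.chi_connectedComponentMk] at hσ
  exact coord_eq_zero_of_reachable hc hρ hIJ (SimpleGraph.ConnectedComponent.exact hσ)
    (fun y hy => coord_eq_zero_of_invariant hα σ hy) x hx

theorem isIndecomposable_of_transitive [CharZero K] (hr : IsSplitting G r) (hc : 2 ≤ c)
    (hρ : Continuous[krullTopology K L, ⊥] ρ)
    (htrans : ∀ C D : G.ConnectedComponent, ∃ σ : Gal(L/K), chi G (ρ σ) C = D) :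
    IsIndecomposable K (form K r ρ c) := by
  rintro ⟨I, J, hI, hJ, hIJ⟩
  by_cases hE : ∃ α β, G.Adj α β
  · obtain ⟨α, β, h⟩ := hE
    rcases coord_eq_zero_or_of_adj hc hρ hIJ h with h | h
    · exact hI (eq_bot_of_coord_eq_zero_of_transitive hr hc hρ htrans hIJ fun x hx => (h x hx).1)
    · exact hJ (eq_bot_of_coord_eq_zero_of_transitive hr hc hρ htrans hIJ.symm
        fun x hx => (h x hx).1)
  -- Without edges all components are singletons, which `χ` fixes, so transitivity leaves at most
  -- one vertex.
  · push Not at hE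
    have hsub : ∀ C : G.ConnectedComponent, C.supp.Subsingleton := fun C => by
      by_contra hC
      obtain ⟨α, hα⟩ := C.nonempty_supp
      obtain ⟨γ, hγ⟩ := exists_adj_of_not_subsingleton hC hα
      exact hE α γ hγ
    have : Subsingleton S := ⟨fun α β => by
      obtain ⟨σ, hσ⟩ := htrans (G.connectedComponentMk α) (G.connectedComponentMk β)
      have h : G.connectedComponentMk α = G.connectedComponentMk β :=
        (chiFun_of_subsingleton (ρ σ) (hsub _)).symm.trans hσ
      exact hsub (G.connectedComponentMk β) h rfl⟩
    -- The algebra is now spanned over `L` by the vertex `α`, hence by any `p` with nonzero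
    -- coordinate. So `J` lies in the `L`-span of `I`, and by descent in `I`.
    obtain ⟨p, hp, α, hα⟩ : ∃ p ∈ idealSubgroup I, ∃ α, coord L G c α p ≠ 0 := by
      by_contra! h
      exact hI (eq_bot_of_coord_eq_zero hρ hIJ h)
    refine hJ (eq_bot_of_forall_eq_zero fun q hq =>
      eq_zero_of_mem_of_mem hIJ.disjoint (mem_idealSubgroup_of_mem_span ?_ hq.1) hq)
    have h : q = (coord L G c α q * (coord L G c α p)⁻¹) • p := by
      calc q = coord L G c α q • vertex L G c α := eq_coord_smul_vertex α q
        _ = (coord L G c α q * (coord L G c α p)⁻¹) • coord L G c α p • vertex L G c α := by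
          rw [smul_smul, inv_mul_cancel_right₀ hα]
        _ = _ := by rw [← eq_coord_smul_vertex α p]
    rw [h]
    exact Submodule.smul_mem _ _ (Submodule.subset_span hp)

end Ideals

theorem isIndecomposable_form_iff {K : Type w} {L : Type v} [Field K] [CharZero K] [Field L]
    [Algebra K L] [IsGalois K L] {S : Type u} [Finite S] {G : SimpleGraph S}
    {r : AutQuot G →* (G ≃g G)} (hr : IsSplitting G r) {c : ℕ} (hc : 1 < c)
    {ρ : Gal(L/K) →* AutQuot G} (hρ : Continuous[krullTopology K L, ⊥] ρ) :
    IsIndecomposable K (form K r ρ c) ↔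
      ∀ C D : G.ConnectedComponent, ∃ σ : Gal(L/K), chi G (ρ σ) C = D := by
  have : NeZero c := ⟨by omega⟩
  refine ⟨fun h => ?_, isIndecomposable_of_transitive hr hc hρ⟩
  by_contra! hne
  obtain ⟨C, D, hCD⟩ := hne
  -- The set `U` is the union of the components in the orbit of `C`. It misses the vertices of `D`.
  refine h (isDecomposable_of_invariant
    (U := {α | ∃ σ, chi G (ρ σ) C = G.connectedComponentMk α}) ?_ ?_ ?_ ?_)
  · rintro α β hαβ ⟨σ, hσ⟩
    exact ⟨σ, hσ.trans (SimpleGraph.ConnectedComponent.connectedComponentMk_eq_of_adj hαβ)⟩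
  · intro σ α
    simp only [Set.mem_ofPred_eq, ← hr.chi_connectedComponentMk]
    constructor
    · rintro ⟨τ, hτ⟩
      exact ⟨σ⁻¹ * τ, by rw [map_mul, map_mul, Equiv.Perm.mul_apply, hτ, map_inv, map_inv,
        ← Equiv.Perm.mul_apply, inv_mul_cancel, Equiv.Perm.one_apply]⟩
    · rintro ⟨τ, hτ⟩
      exact ⟨σ * τ, by rw [map_mul, map_mul, Equiv.Perm.mul_apply, hτ]⟩
  · obtain ⟨α, hα⟩ := C.nonempty_supp
    exact ⟨α, 1, by rw [map_one, map_one]; exact Eq.symm hα⟩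
  · obtain ⟨β, hβ⟩ := D.nonempty_supp
    exact ⟨β, fun ⟨σ, hσ⟩ => hCD σ (hσ.trans hβ)⟩

end GraphLie

end

theorem theoremC {S : Type*} [Finite S] (G : SimpleGraph S)
    (r : GraphLie.AutQuot G →* (G ≃g G)) (hr : GraphLie.IsSplitting G r)
    (c : ℕ) (hc : 1 < c)
    (K : Subfield ℂ) (L : IntermediateField K ℂ) [IsGalois K L]
    (ρ : Gal(L/K) →* GraphLie.AutQuot G)
    (hρ : Continuous[krullTopology K L, ⊥] ρ) :
    GraphLie.IsIndecomposable K (GraphLie.form K r ρ c) ↔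
      ∀ C D : G.ConnectedComponent, ∃ σ : Gal(L/K), GraphLie.chi G (ρ σ) C = D :=
  GraphLie.isIndecomposable_form_iff hr hc hρ
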